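/- Let $p=(p_{kl})_{k,l\in\{0,1\}}$ be a probability vector with all $p_{kl}>0$. Let $X_i=\{0,1\}\times\{0,1\}$ ($i\in\mathbb N$) with the measure $\nu_i(\{(k,l)\})=p_{kl}$, and $(X,\mu)=\prod_i(X_i,\nu_i)$; write $x=(x_i)$, $x_i=(x_i^{(0)},x_i^{(1)})$. Let $\mathfrak S_\infty$ be the group of finite permutations of $\mathbb N$ and $G=(\mathbb Z_2)^{\infty}_e\rtimes\mathfrak S_\infty$ the wreath product, where $(\mathbb Z_2)^\infty_e$ is the group of finitely supported sequences and $s\gamma s^{-1}=(\gamma_{s^{-1}(i)})_i$. Let $\pi_\mu$ be the unitary representation of $G\times G$ in $L^2(X,\mu)$ given by $$(\pi_\mu(s_0,s_1)\zeta)(x)=\Big(\tfrac{d\mu(\mathfrak a x)}{d\mu(x)}\Big)^{1/2}\zeta(\mathfrak a x),\quad (\mathfrak a x)_i^{(k)}=x_{s_k(i)}^{(k)},\qquad (\pi_\mu(\gamma^{(0)},\gamma^{(1)})\zeta)(x)=(-1)^{\sum_{i,k}\gamma_i^{(k)}x_i^{(k)}}\zeta(x),$$ and put $\pi_\mu^{(0)}(g)=\pi_\mu(g,e)$,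 $\pi_\mu^{(1)}(g)=\pi_\mu(e,g)$. Let $m=(\sqrt{p_{kl}})\in M_2(\mathbb C)$ and let $\mathfrak H$ be the infinite tensor product Hilbert space $\bigotimes_i (M_2(\mathbb C),\operatorname{Tr}(b^*a),m)$, that is, the completion of the span of the tensors $a_1\otimes a_2\otimes\cdots$ with $a_i=m$ for all but finitely many $i$. Let $\mathfrak J:L^2(X,\mu)\to\mathfrak H$ be the unitary operator with $\mathfrak J\big(\prod_{i\le n}f_i(x_i)\big)=\mathfrak J_1f_1\otimes\cdots\otimes\mathfrak J_nf_n\otimes m\otimes m\otimes\cdots$, where $\mathfrak J_if=(f(k,l)\sqrt{p_{kl}})_{k,l}$. Let $\mathcal L(\mathfrak H)$ and $\mathcal R(\mathfrak H)$ be the $W^*$-algebras on $\mathfrak H$ generated by the left, respectively right, multiplications by the elements $a_1\otimes\cdots\otimes a_n\otimes I_2\otimes I_2\otimes\cdots$. The representation $\pi_\mu$, the unitary $\mathfrak J$ and these bounded multiplication operators exist, and $$\pi_\mu^{(0)}(G)''=\mathfrak J^{-1}\mathcal L(\mathfrak H)\mathfrak J,\qquad \pi_\mu^{(1)}(G)''=\mathfrak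 J^{-1}\mathcal R(\mathfrak H)\mathfrak J .$$ Suppose moreover that $\det[p_{kl}]\neq0$. Then $\xi=m\otimes m\otimes\cdots$ is cyclic and separating for $\mathcal L(\mathfrak H)$; the antilinear operators $a\xi\mapsto a^*\xi$ ($a\in\mathcal L(\mathfrak H)$) and $a'\xi\mapsto a'^*\xi$ ($a'\in\mathcal R(\mathfrak H)$) have closures $S$ and $F$, and $F=S^*$. The Okounkov operators $\mathcal O_j=\lim_{n\to\infty}\frac1n\sum_{l=1}^n\pi_\mu^{(0)}((j,l))$ exist in the strong operator topology and are boundedly invertible, and the modular operator $\Delta_\xi=FS$ is given by conjugation with them: for every $n$ and every left multiplication $a$ by an element $a_1\otimes\cdots\otimes a_n\otimes I_2\otimes I_2\otimes\cdots$, $$\Delta_\xi(a\xi)=P_n\,a\,P_n^{-1}\,\xi,\qquad P_n=\prod_{j=1}^n\mathfrak J\,\mathcal O_j\,\mathfrak J^{-1},$$ and the linear span of these vectors $a\xi$ is a core for $\Delta_\xi$. -/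

import Mathlib

open MeasureTheory Filter Topology

noncomputable section

/-! ### The wreath product `ℤ/2 ≀ 𝔖_∞` -/

/-- The group `𝔖_∞` of finite permutations of `ℕ`. -/
def FinPerm : Subgroup (Equiv.Perm ℕ) where
  carrier := {s | {i | s i ≠ i}.Finite}
  one_mem' := by simp
  mul_mem' := by
    intro s t hs ht
    refine (hs.union ht).subset fun i hi => ?_
    by_cases h : t i = i
    · left
      simpa [h] using hi
    · right
      exact h
  inv_mem' := by
    intro s hs
    refine hs.subset fun i hi h => hi ?_
    rw [Equiv.Perm.inv_eq_iff_eq]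
    exact h.symm

/-- The transposition `(k, l)` (the identity if `k = l`). -/
def transp (k l : ℕ) : FinPerm :=
  ⟨Equiv.swap k l, by
    refine (Set.toFinite {k, l}).subset fun i hi => ?_
    by_contra h
    simp only [Set.mem_insert_iff, Set.mem_singleton_iff, not_or] at h
    exact hi (Equiv.swap_apply_of_ne_of_ne h.1 h.2)⟩

/-- The group `(ℤ/2)^∞_e` of finitely supported sequences (additive notation inside
`Multiplicative`). -/
abbrev GammaInf : Type := Multiplicative (ℕ →₀ ZMod 2)

/-- The permutation action `(s • γ)_i = γ_{s⁻¹(i)}`. -/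
def permAction : FinPerm →* MulAut GammaInf where
  toFun s := AddEquiv.toMultiplicative (Finsupp.domCongr (s : Equiv.Perm ℕ))
  map_one' := by
    ext γ
    rfl
  map_mul' s t := by
    ext γ
    rfl

/-- The wreath product `G = (ℤ/2)^∞_e ⋊ 𝔖_∞`. -/
abbrev Wreath : Type := GammaInf ⋊[permAction] FinPerm

/-- The embedding `𝔖_∞ → G`. -/
def permG (s : FinPerm) : Wreath := SemidirectProduct.inr s

/-- The embedding `(ℤ/2)^∞_e → G`. -/
def gammaG (γ : ℕ →₀ ZMod 2) : Wreath := SemidirectProduct.inl (Multiplicative.ofAdd γ)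

/-! ### The measure space `(X, μ)` and the representation `π_μ` of `G × G` -/

/-- One factor `X_i = {0,1} × {0,1}`. -/
abbrev Site : Type := Fin 2 × Fin 2

/-- The product measure `μ` on `X = ∏ X_i`, every factor carrying the probability `p`. -/
def prodMeasure (p : PMF Site) : Measure (ℕ → Site) := Measure.infinitePi fun _ => p.toMeasure

instance (p : PMF Site) : IsProbabilityMeasure (prodMeasure p) := by
  unfold prodMeasure
  infer_instance

/-- The Hilbert space `L²(X, μ)`. -/
abbrev L2X (p : PMF Site) : Type := Lp ℂ 2 (prodMeasure p)

/-- The map `𝔞_{(s₀,s₁)} : X → X`, `(𝔞 x)_i^{(k)} = x_{s_k(i)}^{(k)}`. -/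
def actX (s₀ s₁ : FinPerm) (x : ℕ → Site) : ℕ → Site :=
  fun i => ((x (s₀.1 i)).1, (x (s₁.1 i)).2)

/-- The Radon-Nikodym derivative `dμ(𝔞_g x) / dμ(x)`: the density of the measure
`A ↦ μ(𝔞_g A)`, which is the image of `μ` under `𝔞_{g⁻¹} = 𝔞_g⁻¹`. -/
def rnX (p : PMF Site) (s₀ s₁ : FinPerm) (x : ℕ → Site) : ℝ :=
  (((prodMeasure p).map (actX s₀⁻¹ s₁⁻¹)).rnDeriv (prodMeasure p) x).toReal

/-- The exponent `∑_i γ_i^{(0)} x_i^{(0)} + ∑_i γ_i^{(1)} x_i^{(1)}`. -/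
def signExp (γ₀ γ₁ : ℕ →₀ ZMod 2) (x : ℕ → Site) : ℕ :=
  ∑ i ∈ γ₀.support, (γ₀ i).val * ((x i).1 : ℕ) + ∑ i ∈ γ₁.support, (γ₁ i).val * ((x i).2 : ℕ)

/-- `π` is the representation `π_μ` of `G × G` in `L²(X, μ)`. -/
structure IsRepMu (p : PMF Site)
    (π : Wreath × Wreath →* unitary (L2X p →L[ℂ] L2X p)) : Prop where
  perm : ∀ (s₀ s₁ : FinPerm) (ζ : L2X p),
    ((π (permG s₀, permG s₁) : L2X p →L[ℂ] L2X p) ζ : (ℕ → Site) → ℂ) =ᵐ[prodMeasure p]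
      fun x => (Real.sqrt (rnX p s₀ s₁ x) : ℂ) * ζ (actX s₀ s₁ x)
  gamma : ∀ (γ₀ γ₁ : ℕ →₀ ZMod 2) (ζ : L2X p),
    ((π (gammaG γ₀, gammaG γ₁) : L2X p →L[ℂ] L2X p) ζ : (ℕ → Site) → ℂ) =ᵐ[prodMeasure p]
      fun x => (-1 : ℂ) ^ signExp γ₀ γ₁ x * ζ x

/-- The operators `π_μ^{(0)}(G)`. -/
def rep0 {p : PMF Site} (π : Wreath × Wreath →* unitary (L2X p →L[ℂ] L2X p)) :
    Set (L2X p →L[ℂ] L2X p) :=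
  Set.range fun g : Wreath => (π (g, 1) : L2X p →L[ℂ] L2X p)

/-- The operators `π_μ^{(1)}(G)`. -/
def rep1 {p : PMF Site} (π : Wreath × Wreath →* unitary (L2X p →L[ℂ] L2X p)) :
    Set (L2X p →L[ℂ] L2X p) :=
  Set.range fun g : Wreath => (π (1, g) : L2X p →L[ℂ] L2X p)

/-- `O` is the Okounkov operator `𝒪_k^{(0)}`, the strong limit of
`n⁻¹ ∑_{l < n} π_μ^{(0)}((k, l))`. -/
def IsOkounkov {p : PMF Site} (π : Wreath × Wreath →* unitary (L2X p →L[ℂ] L2X p)) (k : ℕ)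
    (O : L2X p →L[ℂ] L2X p) : Prop :=
  ∀ ζ : L2X p, Tendsto
    (fun n : ℕ => (n : ℂ)⁻¹ • ∑ l ∈ Finset.range n,
      (π (permG (transp k l), 1) : L2X p →L[ℂ] L2X p) ζ) atTop (𝓝 (O ζ))

/-! ### The infinite tensor product of the pairs `(M₂(ℂ), 𝔍_i(𝕀))` -/

/-- The algebra `M₂(ℂ)`. -/
abbrev M2 : Type := Matrix (Fin 2) (Fin 2) ℂ

/-- The identification `𝔍_i : L²(X_i, ν_i) → M₂(ℂ)` which sends the orthonormal basis
`χ_{kl} / √p_{kl}` to the matrix units; so `f` goes to the matrix `(f(k,l) √p_{kl})`. -/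
def siteMatrix (p : PMF Site) (f : Site → ℂ) : M2 :=
  Matrix.of fun k l => f (k, l) * (Real.sqrt (p (k, l)).toReal : ℂ)

/-- The reference vector `𝔍_i(𝕀) = (√p_{kl})`. -/
def refMatrix (p : PMF Site) : M2 := siteMatrix p 1

/-- Elementary tensors `a₀ ⊗ a₁ ⊗ ⋯` with `a_i = 𝔍_i(𝕀)` for all but finitely many `i`. -/
structure ElemTensor (p : PMF Site) where
  /-- the sequence of factors -/
  toFun : ℕ → M2
  eventually_ref : ∀ᶠ i in atTop, toFun i = refMatrix p

/-- The inner product `∏_i Tr(a_i^* b_i)` of two elementary tensors, linear in `b`. -/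
def elemInner {p : PMF Site} (a b : ElemTensor p) : ℂ :=
  ∏ᶠ i, ((a.toFun i).conjTranspose * b.toFun i).trace

lemma trace_refMatrix (p : PMF Site) :
    ((refMatrix p).conjTranspose * refMatrix p).trace = 1 := by
  have h : ∑ z, (p z).toReal = 1 := by
    rw [← ENNReal.toReal_sum fun z _ => p.apply_ne_top z, ← tsum_fintype (L := .unconditional _),
      p.tsum_coe, ENNReal.toReal_one]
  have hs : ∀ z, (Real.sqrt (p z).toReal : ℂ) * (Real.sqrt (p z).toReal : ℂ)
      = ((p z).toReal : ℂ) := by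
    intro z
    rw [← Complex.ofReal_mul, Real.mul_self_sqrt ENNReal.toReal_nonneg]
  simp only [Matrix.trace, Matrix.diag, Matrix.mul_apply, Matrix.conjTranspose_apply, refMatrix,
    siteMatrix, Matrix.of_apply, Pi.one_apply, one_mul, RCLike.star_def, Complex.conj_ofReal, hs]
  rw [Finset.sum_comm, ← Fintype.sum_prod_type' fun k l => ((p (k, l)).toReal : ℂ)]
  exact_mod_cast h

lemma elemInner_eq_prod {p : PMF Site} (a b : ElemTensor p) (N : ℕ)
    (ha : ∀ i, N ≤ i → a.toFun i = refMatrix p) (hb : ∀ i, N ≤ i → b.toFun i = refMatrix p) :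
    elemInner a b
      = ∏ i ∈ Finset.range N, ((a.toFun i).conjTranspose * b.toFun i).trace := by
  refine finprod_eq_prod_of_mulSupport_subset _ fun i hi => ?_
  by_contra h
  simp only [Finset.coe_range, Set.mem_Iio, not_lt] at h
  exact hi (by simp only [ha i h, hb i h, trace_refMatrix])

lemma elemInner_conj {p : PMF Site} (a b : ElemTensor p) :
    (starRingEnd ℂ) (elemInner b a) = elemInner a b := by
  obtain ⟨N, hN⟩ := eventually_atTop.1 (a.eventually_ref.and b.eventually_ref)
  rw [elemInner_eq_prod b a N (fun i hi => (hN i hi).2) (fun i hi => (hN i hi).1),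
    elemInner_eq_prod a b N (fun i hi => (hN i hi).1) (fun i hi => (hN i hi).2), map_prod]
  refine Finset.prod_congr rfl fun i _ => ?_
  rw [starRingEnd_apply, ← Matrix.trace_conjTranspose, Matrix.conjTranspose_mul,
    Matrix.conjTranspose_conjTranspose]

/-- Formal linear combinations of elementary tensors. -/
def PreTensor (p : PMF Site) : Type := ElemTensor p →₀ ℂ

instance (p : PMF Site) : AddCommGroup (PreTensor p) :=
  inferInstanceAs (AddCommGroup (ElemTensor p →₀ ℂ))

instance (p : PMF Site) : Module ℂ (PreTensor p) :=
  inferInstanceAs (Module ℂ (ElemTensor p →₀ ℂ))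

/-- The sesquilinear extension of `elemInner`. -/
def preInner {p : PMF Site} (x y : ElemTensor p →₀ ℂ) : ℂ :=
  x.sum fun a c => y.sum fun b d => (starRingEnd ℂ) c * d * elemInner a b

lemma preInner_self {p : PMF Site} (x : ElemTensor p →₀ ℂ) : 0 ≤ (preInner x x).re := by
  have hN : ∃ N, ∀ a ∈ x.support, ∀ i, N ≤ i → a.toFun i = refMatrix p := by
    have h : ∀ᶠ i in atTop, ∀ a ∈ x.support, a.toFun i = refMatrix p :=
      (Filter.eventually_all_finset x.support).2 fun a _ => a.eventually_ref
    obtain ⟨N, hN⟩ := eventually_atTop.1 h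
    exact ⟨N, fun a ha i hi => hN i hi a ha⟩
  obtain ⟨N, hN⟩ := hN
  let φ : ElemTensor p → (Fin N → Site) → ℂ := fun a K =>
    ∏ i : Fin N, a.toFun i (K i).1 (K i).2
  have key : ∀ a ∈ x.support, ∀ b ∈ x.support,
      elemInner a b = ∑ K, (starRingEnd ℂ) (φ a K) * φ b K := by
    intro a ha b hb
    rw [elemInner_eq_prod a b N (hN a ha) (hN b hb), Finset.prod_range]
    have : ∀ i : Fin N, ((a.toFun i).conjTranspose * b.toFun i).trace
        = ∑ z : Site, (starRingEnd ℂ) (a.toFun i z.1 z.2) * b.toFun i z.1 z.2 := by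
      intro i
      rw [Fintype.sum_prod_type, Finset.sum_comm]
      rfl
    simp only [this, φ, map_prod, ← Finset.prod_mul_distrib]
    exact Finset.prod_univ_sum (fun _ => Finset.univ)
      (fun (i : Fin N) (z : Site) =>
        (starRingEnd ℂ) (a.toFun i z.1 z.2) * b.toFun i z.1 z.2) |>.trans (by simp)
  have : preInner x x
      = ∑ K, (starRingEnd ℂ) (∑ a ∈ x.support, x a * φ a K) * ∑ a ∈ x.support, x a * φ a K := by
    simp only [preInner, Finsupp.sum, map_sum, map_mul, Finset.sum_mul_sum]
    rw [Finset.sum_comm (s := Finset.univ)]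
    refine Finset.sum_congr rfl fun a ha => ?_
    rw [Finset.sum_comm (s := Finset.univ)]
    refine Finset.sum_congr rfl fun b hb => ?_
    rw [key a ha b hb, Finset.mul_sum]
    refine Finset.sum_congr rfl fun K _ => ?_
    ring
  rw [this, Complex.re_sum]
  refine Finset.sum_nonneg fun K _ => ?_
  rw [mul_comm, Complex.mul_conj, Complex.ofReal_re]
  exact Complex.normSq_nonneg _

/-- The positive semidefinite inner product on formal combinations of elementary tensors. -/
instance preTensorCore (p : PMF Site) : PreInnerProductSpace.Core ℂ (PreTensor p) where
  inner x y := preInner x y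
  conj_inner_symm x y := by
    change (starRingEnd ℂ) (preInner _ _) = preInner _ _
    simp only [preInner, Finsupp.sum, map_sum, map_mul, Complex.conj_conj, elemInner_conj]
    rw [Finset.sum_comm]
    refine Finset.sum_congr rfl fun a _ => Finset.sum_congr rfl fun b _ => ?_
    ring
  re_inner_nonneg x := preInner_self x
  add_left x y z := by
    refine Finsupp.sum_add_index' (f := (x : ElemTensor p →₀ ℂ)) (fun a => ?_) fun a c d => ?_
    · simp only [map_zero, zero_mul]
      exact Finset.sum_const_zero
    · simp only [map_add, add_mul]
      exact Finset.sum_add_distrib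
  smul_left x y r := by
    refine (Finsupp.sum_smul_index (g := (x : ElemTensor p →₀ ℂ)) fun a => ?_).trans ?_
    · simp only [map_zero, zero_mul]
      exact Finset.sum_const_zero
    · simp only [preInner, Finsupp.sum, map_mul, Finset.mul_sum, mul_assoc]

instance (p : PMF Site) : SeminormedAddCommGroup (PreTensor p) :=
  InnerProductSpace.Core.toSeminormedAddCommGroup (𝕜 := ℂ)

instance (p : PMF Site) : InnerProductSpace ℂ (PreTensor p) :=
  InnerProductSpace.ofCore (preTensorCore p)

/-- An elementary tensor as a formal linear combination. -/
def preTensor {p : PMF Site} (a : ElemTensor p) : PreTensor p :=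
  (Finsupp.single a 1 : ElemTensor p →₀ ℂ)

/-- The infinite tensor product `𝔥 = ⨂_i (M₂(ℂ), Tr(b^* a), 𝔍_i(𝕀))`: the Hilbert space
completion of the span of the elementary tensors. -/
abbrev TensorH (p : PMF Site) : Type := UniformSpace.Completion (PreTensor p)

/-- The elementary tensor `a₀ ⊗ a₁ ⊗ ⋯` as a vector of `𝔥`. -/
def tensor {p : PMF Site} (a : ElemTensor p) : TensorH p :=
  (preTensor a : TensorH p)

/-- The vector `ξ = 𝔍_0(𝕀) ⊗ 𝔍_1(𝕀) ⊗ ⋯`. -/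
def refVector (p : PMF Site) : TensorH p :=
  tensor ⟨fun _ => refMatrix p, Eventually.of_forall fun _ => rfl⟩

/-! ### The identification `𝔍 = ⨂ 𝔍_i` -/

/-- The function `x ↦ ∏_{i < n} f_i(x_i)` as an element of `L²(X, μ)`. -/
def elemFun (p : PMF Site) (n : ℕ) (f : ℕ → Site → ℂ) : L2X p :=
  MemLp.toLp (μ := prodMeasure p) (p := 2) (fun x => ∏ i ∈ Finset.range n, f i (x i)) <| by
    refine MemLp.of_bound (Measurable.aestronglyMeasurable ?_)
      (∏ i ∈ Finset.range n, ∑ z, ‖f i z‖) (Eventually.of_forall fun x => ?_)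
    · exact Finset.measurable_prod _ fun i _ =>
        (measurable_of_finite (f i)).comp (measurable_pi_apply i)
    · rw [norm_prod]
      exact Finset.prod_le_prod (fun _ _ => norm_nonneg _) fun i _ =>
        Finset.single_le_sum (f := fun z => ‖f i z‖) (fun _ _ => norm_nonneg _)
          (Finset.mem_univ (x i))

/-- The elementary tensor `𝔍_0 f_0 ⊗ ⋯ ⊗ 𝔍_{n-1} f_{n-1} ⊗ 𝔍_n(𝕀) ⊗ 𝔍_{n+1}(𝕀) ⊗ ⋯`. -/
def elemFunTensor (p : PMF Site) (n : ℕ) (f : ℕ → Site → ℂ) : ElemTensor p :=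
  ⟨fun i => if i < n then siteMatrix p (f i) else refMatrix p,
    eventually_atTop.2 ⟨n, fun i hi => by simp [not_lt.2 hi]⟩⟩

/-- `J` is the unitary `𝔍 = ⨂ 𝔍_i : L²(X, μ) → 𝔥`. -/
def IsTensorId (p : PMF Site) (J : L2X p ≃ₗᵢ[ℂ] TensorH p) : Prop :=
  ∀ (n : ℕ) (f : ℕ → Site → ℂ), J (elemFun p n f) = tensor (elemFunTensor p n f)

/-! ### The algebras of left and of right multiplications -/

/-- The double commutant of a set of bounded operators. -/
def doubleCommutant {H : Type*} [NormedAddCommGroup H] [InnerProductSpace ℂ H]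
    (S : Set (H →L[ℂ] H)) : Set (H →L[ℂ] H) :=
  Set.centralizer (Set.centralizer S)

/-- The `W^*`-algebra generated by a set of bounded operators. -/
def wstarGenerated {H : Type*} [NormedAddCommGroup H] [InnerProductSpace ℂ H] [CompleteSpace H]
    (S : Set (H →L[ℂ] H)) : Set (H →L[ℂ] H) :=
  doubleCommutant (S ∪ star '' S)

/-- Elements `b₀ ⊗ b₁ ⊗ ⋯ ⊗ b_{n-1} ⊗ I₂ ⊗ I₂ ⊗ ⋯`. -/
structure LocalElem where
  /-- the sequence of factors -/
  toFun : ℕ → M2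
  eventually_one : ∀ᶠ i in atTop, toFun i = 1

/-- The elementary tensor `b₀a₀ ⊗ b₁a₁ ⊗ ⋯`. -/
def LocalElem.mulLeft {p : PMF Site} (b : LocalElem) (a : ElemTensor p) : ElemTensor p :=
  ⟨fun i => b.toFun i * a.toFun i, by
    filter_upwards [b.eventually_one, a.eventually_ref] with i h₁ h₂
    rw [h₁, h₂, one_mul]⟩

/-- The elementary tensor `a₀b₀ ⊗ a₁b₁ ⊗ ⋯`. -/
def LocalElem.mulRight {p : PMF Site} (b : LocalElem) (a : ElemTensor p) : ElemTensor p :=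
  ⟨fun i => a.toFun i * b.toFun i, by
    filter_upwards [b.eventually_one, a.eventually_ref] with i h₁ h₂
    rw [h₁, h₂, mul_one]⟩

/-- `T` is the operator of left multiplication by `b` in `𝔥`. -/
def IsLeftMul {p : PMF Site} (b : LocalElem) (T : TensorH p →L[ℂ] TensorH p) : Prop :=
  ∀ a : ElemTensor p, T (tensor a) = tensor (b.mulLeft a)

/-- `T` is the operator of right multiplication by `b` in `𝔥`. -/
def IsRightMul {p : PMF Site} (b : LocalElem) (T : TensorH p →L[ℂ] TensorH p) : Prop :=
  ∀ a : ElemTensor p, T (tensor a) = tensor (b.mulRight a)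

/-- The `W^*`-algebra `ℒ(𝔥)` generated by the left multiplications. -/
def leftAlg (p : PMF Site) : Set (TensorH p →L[ℂ] TensorH p) :=
  wstarGenerated {T | ∃ b : LocalElem, IsLeftMul b T}

/-- The `W^*`-algebra `ℛ(𝔥)` generated by the right multiplications. -/
def rightAlg (p : PMF Site) : Set (TensorH p →L[ℂ] TensorH p) :=
  wstarGenerated {T | ∃ b : LocalElem, IsRightMul b T}

/-- `𝔍⁻¹ T 𝔍`. -/
def pullOp {p : PMF Site} (J : L2X p ≃ₗᵢ[ℂ] TensorH p) (T : TensorH p →L[ℂ] TensorH p) :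
    L2X p →L[ℂ] L2X p :=
  (J.symm.toContinuousLinearEquiv : TensorH p →L[ℂ] L2X p) ∘L T ∘L
    (J.toContinuousLinearEquiv : L2X p →L[ℂ] TensorH p)

/-- `𝔍 T 𝔍⁻¹`. -/
def pushOp {p : PMF Site} (J : L2X p ≃ₗᵢ[ℂ] TensorH p) (T : L2X p →L[ℂ] L2X p) :
    TensorH p →L[ℂ] TensorH p :=
  (J.toContinuousLinearEquiv : L2X p →L[ℂ] TensorH p) ∘L T ∘L
    (J.symm.toContinuousLinearEquiv : TensorH p →L[ℂ] L2X p)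

/-! ### Tomita-Takesaki theory -/

section Tomita

variable {H : Type*} [NormedAddCommGroup H] [InnerProductSpace ℂ H] [CompleteSpace H]

/-- The closure of the graph of the antilinear operator `aξ ↦ a^*ξ`, `a ∈ M`. -/
def tomitaGraph (M : Set (H →L[ℂ] H)) (ξ : H) : Set (H × H) :=
  closure {z | ∃ a ∈ M, z = (a ξ, (star a) ξ)}

/-- `Δ` is the modular operator of `(M, ξ)`, where `M` and `N` are commuting algebras: `ξ` is
cyclic and separating for `M`, the antilinear operators `aξ ↦ a^*ξ` (`a ∈ M`) and
`a'ξ ↦ a'^*ξ` (`a' ∈ N`) have closures `S` and `F`, `F = S^*`, and `Δ = F S`. -/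
structure IsModularOperator (M N : Set (H →L[ℂ] H)) (ξ : H) (Δ : H →ₗ.[ℂ] H) : Prop where
  cyclic : Dense {v : H | ∃ a ∈ M, v = a ξ}
  separating : ∀ a ∈ M, a ξ = 0 → a = 0
  closable_S : ∀ u v w, (u, v) ∈ tomitaGraph M ξ → (u, w) ∈ tomitaGraph M ξ → v = w
  closable_F : ∀ u v w, (u, v) ∈ tomitaGraph N ξ → (u, w) ∈ tomitaGraph N ξ → v = w
  adjoint : ∀ u v, (u, v) ∈ tomitaGraph N ξ ↔
    ∀ x y, (x, y) ∈ tomitaGraph M ξ → inner ℂ y u = inner ℂ v x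
  graph : ∀ u w, (u, w) ∈ Δ.graph ↔
    ∃ v, (u, v) ∈ tomitaGraph M ξ ∧ (v, w) ∈ tomitaGraph N ξ

end Tomita

/-- The span of the vectors `aξ`, where `a = a₀ ⊗ ⋯ ⊗ a_{n-1} ⊗ I₂ ⊗ I₂ ⊗ ⋯`. -/
def localVectors (p : PMF Site) : Submodule ℂ (TensorH p) :=
  Submodule.span ℂ {v | ∃ (a : LocalElem) (A : TensorH p →L[ℂ] TensorH p),
    IsLeftMul a A ∧ v = A (refVector p)}

/-- The operator `⨂_{j < n} 𝔍_j 𝒪_j^{(0,j)} 𝔍_j⁻¹ = ∏_{j < n} 𝔍 𝒪_j 𝔍⁻¹`. -/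
def okounkovProd {p : PMF Site} (J : L2X p ≃ₗᵢ[ℂ] TensorH p)
    (O : ℕ → (L2X p →L[ℂ] L2X p)) (n : ℕ) : TensorH p →L[ℂ] TensorH p :=
  ((List.range n).map fun j => pushOp J (O j)).prod

end

/-!
The unitary `𝔍` turns the transposition `(k l)` acting on one of the two coordinates into left or
right multiplication by `∑ e_ij ⊗ e_ji` in the tensor factors `k` and `l`, and the sign characters
into multiplications by diagonal matrices. By the law of large numbers in the product state of
`ξ = m ⊗ m ⊗ ⋯`, the averages of these transpositions over `l` converge to multiplication by
`m m*` at the site `k` (on the left; by its analogue on the right). No entry of `m` vanishes, so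
these operators and `diag(1, -1)` generate all of `M₂(ℂ)` at each site, and the representation has
the same commutant as the multiplications.

If `m` is invertible, each tensor which agrees with `ξ` from the site `n` on is obtained from `ξ`
by a left and by a right multiplication. Compressing to these finite-dimensional spaces shows that
the graph of `S` is determined by its pairing with the graph of `F`, whence `F = S*`, and that
they span a core for `F S`. Finally `b* ξ` is the right multiplication of `ξ` by `m⁻¹ b* m`, and
the adjoint of that sends `ξ` to `(m m*) b (m m*)⁻¹ ξ`.
-/

noncomputable section

open scoped Matrix InnerProductSpace

/-! ### Isometries prescribed on total families -/

section Isometry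

variable {𝕜 ι E F : Type*} [RCLike 𝕜] [NormedAddCommGroup E] [InnerProductSpace 𝕜 E]
  [NormedAddCommGroup F] [InnerProductSpace 𝕜 F]

lemma inner_linearCombination (u : ι → E) (x y : ι →₀ 𝕜) :
    inner 𝕜 (Finsupp.linearCombination 𝕜 u x) (Finsupp.linearCombination 𝕜 u y)
      = x.sum fun i c => y.sum fun j d => d * ((starRingEnd 𝕜) c * ⟪u i, u j⟫_𝕜) := by
  rw [Finsupp.linearCombination_apply, Finsupp.linearCombination_apply, Finsupp.sum_inner]
  simp only [Finsupp.inner_sum, inner_smul_left, inner_smul_right]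

lemma exists_linearIsometry_of_inner_eq [CompleteSpace F] {u : ι → E} {v : ι → F}
    (hu : Dense (Submodule.span 𝕜 (Set.range u) : Set E))
    (huv : ∀ i j, ⟪v i, v j⟫_𝕜 = ⟪u i, u j⟫_𝕜) :
    ∃ V : E →ₗᵢ[𝕜] F, ∀ i, V (u i) = v i := by
  let U := Finsupp.linearCombination 𝕜 u
  let W := Finsupp.linearCombination 𝕜 v
  have hU : DenseRange U := by
    rw [← Finsupp.range_linearCombination] at hu
    exact hu
  have hnorm : ∀ x, ‖W x‖ = ‖U x‖ := fun x => by
    simp only [U, W, @norm_eq_sqrt_re_inner 𝕜, inner_linearCombination, huv]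
  have hV : ∀ x, W.extendOfNorm U (U x) = W x :=
    LinearMap.extendOfNorm_eq hU ⟨1, fun x => by rw [hnorm, one_mul]⟩
  refine ⟨⟨(W.extendOfNorm U).toLinearMap, fun x => ?_⟩, fun i => ?_⟩
  · induction x using hU.induction_on with
    | hp => exact isClosed_eq (W.extendOfNorm U).continuous.norm continuous_norm
    | ih x => exact (congrArg norm (hV x)).trans (hnorm x)
  · simpa [U, W] using hV (Finsupp.single i 1)

lemma exists_linearIsometryEquiv_of_inner_eq [CompleteSpace E] [CompleteSpace F] {u : ι → E}
    {v : ι → F} (hu : Dense (Submodule.span 𝕜 (Set.range u) : Set E))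
    (hv : Dense (Submodule.span 𝕜 (Set.range v) : Set F))
    (huv : ∀ i j, ⟪v i, v j⟫_𝕜 = ⟪u i, u j⟫_𝕜) :
    ∃ V : E ≃ₗᵢ[𝕜] F, ∀ i, V (u i) = v i := by
  obtain ⟨V, hV⟩ := exists_linearIsometry_of_inner_eq hu huv
  have hspan : (Submodule.span 𝕜 (Set.range v) : Set F) ⊆ Set.range V := by
    refine Submodule.span_le (p := V.toLinearMap.range).2 ?_
    rintro _ ⟨i, rfl⟩
    exact ⟨u i, hV i⟩
  have hsurj : Function.Surjective V := fun y =>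
    V.isometry.isClosedEmbedding.isClosed_range.closure_subset_iff.2 hspan (hv y)
  exact ⟨LinearIsometryEquiv.ofSurjective V hsurj, hV⟩

end Isometry

/-! ### The Hilbert-Schmidt inner product -/

section HilbertSchmidt

variable {m n : Type*} [Fintype m] [Fintype n]

/-- The Hilbert-Schmidt inner product `Tr(x^* y)` of complex matrices, linear in `y`. -/
def hs (x y : Matrix m n ℂ) : ℂ := (xᴴ * y).trace

lemma hs_add_right (x y z : Matrix m n ℂ) : hs x (y + z) = hs x y + hs x z := by
  simp [hs, Matrix.mul_add]

lemma hs_smul_right (c : ℂ) (x y : Matrix m n ℂ) : hs x (c • y) = c * hs x y := by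
  simp [hs]

lemma hs_apply (x y : Matrix m n ℂ) :
    hs x y = ∑ z : m × n, (starRingEnd ℂ) (x z.1 z.2) * y z.1 z.2 := by
  rw [Fintype.sum_prod_type, Finset.sum_comm]
  rfl

lemma hs_mul_left (e : Matrix m m ℂ) (x y : Matrix m n ℂ) : hs (e * x) y = hs x (eᴴ * y) := by
  simp only [hs, Matrix.conjTranspose_mul, Matrix.mul_assoc]

lemma hs_mul_right (e : Matrix n n ℂ) (x y : Matrix m n ℂ) : hs (x * e) y = hs x (y * eᴴ) := by
  rw [hs, hs, Matrix.conjTranspose_mul, Matrix.mul_assoc, Matrix.trace_mul_comm, Matrix.mul_assoc]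

lemma hs_toLin_of_mem_unitary [DecidableEq m] [DecidableEq n] {u : Matrix (m × n) (m × n) ℂ}
    (hu : u ∈ unitary _) (x y : Matrix m n ℂ) :
    hs (Matrix.toLinAlgEquiv (Matrix.stdBasis ℂ m n) u x)
      (Matrix.toLinAlgEquiv (Matrix.stdBasis ℂ m n) u y) = hs x y := by
  let b := Matrix.stdBasis ℂ m n
  have hs_eq (x y : Matrix m n ℂ) : hs x y = star ⇑(b.repr x) ⬝ᵥ ⇑(b.repr y) := hs_apply x y
  have repr_toLin (x : Matrix m n ℂ) : ⇑(b.repr (Matrix.toLinAlgEquiv b u x)) = u *ᵥ b.repr x :=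
    Matrix.repr_toLin b b u x
  rw [hs_eq, repr_toLin, repr_toLin, Matrix.star_mulVec, Matrix.dotProduct_mulVec,
    Matrix.vecMul_vecMul, ← Matrix.star_eq_conjTranspose, Unitary.star_mul_self_of_mem hu,
    Matrix.vecMul_one, hs_eq]

open scoped Matrix.Norms.L2Operator in
lemma span_hs_isometries :
    Submodule.span ℂ {t : Module.End ℂ (Matrix m n ℂ) | ∀ x y, hs (t x) (t y) = hs x y} = ⊤ := by
  classical
  let φ := (Matrix.toLinAlgEquiv (Matrix.stdBasis ℂ m n)).toLinearEquiv
  have hφ : (Submodule.span ℂ (unitary (Matrix (m × n) (m × n) ℂ) : Set _)).map φ.toLinearMap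
      = ⊤ := by
    rw [CStarAlgebra.span_unitary, Submodule.map_top, LinearEquiv.range]
  rw [← top_le_iff, ← hφ, Submodule.map_span]
  refine Submodule.span_mono ?_
  rintro _ ⟨u, hu, rfl⟩
  exact hs_toLin_of_mem_unitary hu

end HilbertSchmidt

/-! ### Elementary tensors -/

variable {p : PMF Site}

namespace ElemTensor

@[ext] lemma ext {a b : ElemTensor p} (h : ∀ i, a.toFun i = b.toFun i) : a = b := by
  cases a
  cases b
  congr
  exact funext h

/-- The elementary tensor obtained from `a` by replacing the factor at the site `k` by `x`. -/
def update (a : ElemTensor p) (k : ℕ) (x : M2) : ElemTensor p :=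
  ⟨Function.update a.toFun k x, by
    filter_upwards [a.eventually_ref, eventually_gt_atTop k] with i href hik
    rw [Function.update_of_ne hik.ne', href]⟩

@[simp] lemma update_self (a : ElemTensor p) (k : ℕ) (x : M2) : (a.update k x).toFun k = x :=
  Function.update_self _ _ _

@[simp] lemma update_of_ne (a : ElemTensor p) {k i : ℕ} (h : i ≠ k) (x : M2) :
    (a.update k x).toFun i = a.toFun i :=
  Function.update_of_ne h _ _

@[simp] lemma update_eq_self (a : ElemTensor p) (k : ℕ) : a.update k (a.toFun k) = a :=
  ext fun i => by simp [update]

@[simp] lemma update_update (a : ElemTensor p) (k : ℕ) (x y : M2) :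
    (a.update k x).update k y = a.update k y :=
  ext fun i => by simp [update]

end ElemTensor

lemma elemInner_factor (a b : ElemTensor p) (k : ℕ) :
    elemInner a b = hs (a.toFun k) (b.toFun k) *
      elemInner (a.update k (refMatrix p)) (b.update k (refMatrix p)) := by
  obtain ⟨N, hN⟩ := eventually_atTop.1
    ((a.eventually_ref.and b.eventually_ref).and (eventually_gt_atTop k))
  have hk : k ∈ Finset.range N :=
    Finset.mem_range.2 (not_le.1 fun h => lt_irrefl _ (hN k h).2)
  rw [elemInner_eq_prod a b N (fun i hi => (hN i hi).1.1) (fun i hi => (hN i hi).1.2),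
    elemInner_eq_prod _ _ N
      (fun i hi => by rw [ElemTensor.update_of_ne _ (hN i hi).2.ne', (hN i hi).1.1])
      (fun i hi => by rw [ElemTensor.update_of_ne _ (hN i hi).2.ne', (hN i hi).1.2]),
    ← Finset.mul_prod_erase _ _ hk, ← Finset.mul_prod_erase _ _ hk, ElemTensor.update_self,
    ElemTensor.update_self, trace_refMatrix, one_mul, hs]
  congr 1
  refine Finset.prod_congr rfl fun i hi => ?_
  rw [ElemTensor.update_of_ne _ (Finset.ne_of_mem_erase hi),
    ElemTensor.update_of_ne _ (Finset.ne_of_mem_erase hi)]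

lemma elemInner_update_right (a b : ElemTensor p) (k : ℕ) (x : M2) :
    elemInner a (b.update k x) = hs (a.toFun k) x *
      elemInner (a.update k (refMatrix p)) (b.update k (refMatrix p)) := by
  rw [elemInner_factor _ _ k, ElemTensor.update_self, ElemTensor.update_update]

lemma elemInner_congr {a b a' b' : ElemTensor p}
    (h : ∀ i, hs (a.toFun i) (b.toFun i) = hs (a'.toFun i) (b'.toFun i)) :
    elemInner a b = elemInner a' b' :=
  finprod_congr h

lemma inner_tensor (a b : ElemTensor p) : ⟪tensor a, tensor b⟫_ℂ = elemInner a b := by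
  refine (UniformSpace.Completion.inner_coe _ _).trans ?_
  change preInner (Finsupp.single a 1) (Finsupp.single b 1) = _
  simp [preInner]

lemma span_preTensor : Submodule.span ℂ (Set.range (preTensor (p := p))) = ⊤ :=
  (Finsupp.basisSingleOne (R := ℂ) (ι := ElemTensor p)).span_eq

lemma dense_span_tensor :
    Dense (Submodule.span ℂ (Set.range (tensor (p := p))) : Set (TensorH p)) := by
  have hspan : Submodule.span ℂ (Set.range (tensor (p := p)))
      = (UniformSpace.Completion.toComplₗᵢ (𝕜 := ℂ) (E := PreTensor p)).toLinearMap.range := by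
    rw [← Submodule.map_top, ← span_preTensor, Submodule.map_span, ← Set.range_comp]
    rfl
  rw [hspan]
  exact UniformSpace.Completion.denseRange_coe

namespace TensorH

lemma ext_inner {x y : TensorH p} (h : ∀ a : ElemTensor p, ⟪tensor a, x⟫_ℂ = ⟪tensor a, y⟫_ℂ) :
    x = y := by
  refine dense_span_tensor.eq_of_inner_right (𝕜 := ℂ) fun v hv => ?_
  have heq : Set.EqOn ((innerₛₗ ℂ).flip x) ((innerₛₗ ℂ).flip y)
      (Submodule.span ℂ (Set.range (tensor (p := p)))) := by
    refine LinearMap.eqOn_span ?_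
    rintro _ ⟨a, rfl⟩
    exact h a
  exact heq hv

lemma clm_ext {E : Type*} [NormedAddCommGroup E] [NormedSpace ℂ E] {S T : TensorH p →L[ℂ] E}
    (h : ∀ a : ElemTensor p, S (tensor a) = T (tensor a)) : S = T := by
  refine ContinuousLinearMap.ext_on dense_span_tensor ?_
  rintro _ ⟨a, rfl⟩
  exact h a

end TensorH

/-! ### Operators acting on one tensor factor -/

/-- The insertion map `x ↦ a₀ ⊗ ⋯ ⊗ a_{k-1} ⊗ x ⊗ a_{k+1} ⊗ ⋯` into the site `k` of `a`. -/
def slot (a : ElemTensor p) (k : ℕ) : M2 →ₗ[ℂ] TensorH p where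
  toFun x := tensor (a.update k x)
  map_add' x y := TensorH.ext_inner fun c => by
    rw [inner_add_right]
    simp only [inner_tensor, elemInner_update_right c, hs_add_right, add_mul]
  map_smul' r x := TensorH.ext_inner fun c => by
    rw [RingHom.id_apply, inner_smul_right]
    simp only [inner_tensor, elemInner_update_right c, hs_smul_right, mul_assoc]

lemma slot_apply (a : ElemTensor p) (k : ℕ) (x : M2) : slot a k x = tensor (a.update k x) := rfl

lemma exists_siteOp_of_isometry (k : ℕ) {t : Module.End ℂ M2}
    (ht : ∀ x y, hs (t x) (t y) = hs x y) :
    ∃ T : TensorH p →L[ℂ] TensorH p, ∀ a, T (tensor a) = slot a k (t (a.toFun k)) := by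
  obtain ⟨V, hV⟩ := exists_linearIsometry_of_inner_eq (dense_span_tensor (p := p))
    (v := fun a => slot a k (t (a.toFun k))) fun a b => by
      rw [slot_apply, slot_apply, inner_tensor, inner_tensor]
      refine elemInner_congr fun i => ?_
      rcases eq_or_ne i k with rfl | h
      · rw [ElemTensor.update_self, ElemTensor.update_self, ht]
      · rw [ElemTensor.update_of_ne _ h, ElemTensor.update_of_ne _ h]
  exact ⟨V.toContinuousLinearMap, hV⟩

lemma exists_siteOp (k : ℕ) (t : Module.End ℂ M2) :
    ∃ T : TensorH p →L[ℂ] TensorH p, ∀ a, T (tensor a) = slot a k (t (a.toFun k)) := by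
  have ht : t ∈ Submodule.span ℂ {t : Module.End ℂ M2 | ∀ x y, hs (t x) (t y) = hs x y} :=
    Submodule.eq_top_iff'.1 span_hs_isometries t
  induction ht using Submodule.span_induction with
  | mem t ht => exact exists_siteOp_of_isometry k ht
  | zero => exact ⟨0, fun a => by simp⟩
  | add s t _ _ ihs iht =>
    obtain ⟨S, hS⟩ := ihs
    obtain ⟨T, hT⟩ := iht
    exact ⟨S + T, fun a => by simp [hS, hT]⟩
  | smul c t _ iht =>
    obtain ⟨T, hT⟩ := iht
    exact ⟨c • T, fun a => by simp [hT]⟩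

/-- The operator on `𝔥` acting by `t` on the factor at the site `k`, as a bare function of `t`;
`siteOp` is its bundled form. -/
def siteOpFun (k : ℕ) (t : Module.End ℂ M2) : TensorH p →L[ℂ] TensorH p :=
  (exists_siteOp k t).choose

lemma siteOpFun_tensor (k : ℕ) (t : Module.End ℂ M2) (a : ElemTensor p) :
    siteOpFun k t (tensor a) = slot a k (t (a.toFun k)) :=
  (exists_siteOp k t).choose_spec a

/-- The representation of `End(M₂(ℂ))` on `𝔥` by operators on the factor at the site `k`. -/
def siteOp (k : ℕ) : Module.End ℂ M2 →ₐ[ℂ] (TensorH p →L[ℂ] TensorH p) :=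
  AlgHom.ofLinearMap
    { toFun := siteOpFun k
      map_add' := fun s t => TensorH.clm_ext fun a => by simp [siteOpFun_tensor]
      map_smul' := fun c t => TensorH.clm_ext fun a => by simp [siteOpFun_tensor] }
    (TensorH.clm_ext fun a => by simp [siteOpFun_tensor, slot_apply])
    fun s t => TensorH.clm_ext fun a => by simp [siteOpFun_tensor, slot_apply]

lemma siteOp_tensor (k : ℕ) (t : Module.End ℂ M2) (a : ElemTensor p) :
    siteOp k t (tensor a) = tensor (a.update k (t (a.toFun k))) :=
  siteOpFun_tensor k t a

/-! ### Left and right multiplications -/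

/-- Left multiplication `e ↦ (x ↦ e x)` for `σ = false` and right multiplication
`e ↦ (x ↦ x eᵀ)` for `σ = true`; the transpose makes both of them homomorphisms, so that the two
sides can be treated together. -/
def side : Bool → M2 →ₐ[ℂ] Module.End ℂ M2
  | false => Algebra.lmul ℂ M2
  | true => AlgHom.ofLinearMap
      { toFun := fun e => LinearMap.mulRight ℂ eᵀ
        map_add' := fun e f => by ext1; simp [mul_add]
        map_smul' := fun c e => by ext1; simp }
      (by ext1; simp) fun e f => LinearMap.ext fun x => by
        simp [Matrix.transpose_mul, Matrix.mul_assoc]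

@[simp] lemma side_false (e x : M2) : side false e x = e * x := rfl

@[simp] lemma side_true (e x : M2) : side true e x = x * eᵀ := rfl

lemma hs_side (σ : Bool) (e x y : M2) : hs (side σ e x) y = hs x (side σ eᴴ y) := by
  cases σ
  · exact hs_mul_left e x y
  · exact hs_mul_right _ x y

lemma side_commute (e f : M2) : Commute (side false e) (side true f) :=
  LinearMap.ext fun x => by simp [Matrix.mul_assoc]

namespace LocalElem

@[ext] lemma ext {b c : LocalElem} (h : ∀ i, b.toFun i = c.toFun i) : b = c := by
  cases b
  cases c
  congr
  exact funext h

instance : One LocalElem := ⟨⟨1, Eventually.of_forall fun _ => rfl⟩⟩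

instance : Mul LocalElem :=
  ⟨fun b c => ⟨b.toFun * c.toFun, by
    filter_upwards [b.eventually_one, c.eventually_one] with i hb hc
    rw [Pi.mul_apply, hb, hc, one_mul]⟩⟩

instance : Star LocalElem :=
  ⟨fun b => ⟨fun i => (b.toFun i)ᴴ, b.eventually_one.mono fun i hi => by
    rw [hi, Matrix.conjTranspose_one]⟩⟩

@[simp] lemma one_toFun (i : ℕ) : (1 : LocalElem).toFun i = 1 := rfl

@[simp] lemma mul_toFun (b c : LocalElem) (i : ℕ) : (b * c).toFun i = b.toFun i * c.toFun i := rfl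

@[simp] lemma star_toFun (b : LocalElem) (i : ℕ) : (star b).toFun i = (b.toFun i)ᴴ := rfl

/-- The element `b₀ᵀ ⊗ b₁ᵀ ⊗ ⋯`, which translates between `IsRightMul` and `IsSideMul true`. -/
def transpose (b : LocalElem) : LocalElem :=
  ⟨fun i => (b.toFun i)ᵀ, b.eventually_one.mono fun i hi => by rw [hi, Matrix.transpose_one]⟩

/-- The element `1 ⊗ ⋯ ⊗ 1 ⊗ e ⊗ 1 ⊗ ⋯` with `e` at the site `k`. -/
def single (k : ℕ) (e : M2) : LocalElem :=
  ⟨Function.update 1 k e, (eventually_gt_atTop k).mono fun i hi => by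
    rw [Function.update_of_ne hi.ne', Pi.one_apply]⟩

@[simp] lemma single_toFun_self (k : ℕ) (e : M2) : (single k e).toFun k = e :=
  Function.update_self _ _ _

@[simp] lemma single_toFun_of_ne {k i : ℕ} (h : i ≠ k) (e : M2) : (single k e).toFun i = 1 :=
  Function.update_of_ne h _ _

/-- The element `b₀ ⊗ ⋯ ⊗ b_{n-1} ⊗ 1 ⊗ 1 ⊗ ⋯`. -/
def truncate (n : ℕ) (b : ℕ → M2) : LocalElem :=
  ⟨fun i => if i < n then b i else 1, eventually_atTop.2 ⟨n, fun _ hi => if_neg hi.not_gt⟩⟩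

lemma truncate_toFun (n : ℕ) (b : ℕ → M2) (i : ℕ) :
    (truncate n b).toFun i = if i < n then b i else 1 := rfl

lemma truncate_succ (n : ℕ) (b : ℕ → M2) : truncate (n + 1) b = truncate n b * single n (b n) := by
  ext1 i
  rcases lt_trichotomy i n with h | rfl | h
  · simp [truncate_toFun, h, h.ne, Nat.lt_succ_of_lt h]
  · simp [truncate_toFun]
  · simp [truncate_toFun, h.ne', h.not_gt, (Nat.succ_le_of_lt h).not_gt]

lemma truncate_toFun_eq {b : LocalElem} {n : ℕ} (h : ∀ i, n ≤ i → b.toFun i = 1) :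
    truncate n b.toFun = b := by
  ext1 i
  rw [truncate_toFun]
  split_ifs with hi
  · rfl
  · exact (h i (not_lt.1 hi)).symm

/-- Factorwise action on elementary tensors, from the left or from the right. -/
def sideMul (σ : Bool) (b : LocalElem) (a : ElemTensor p) : ElemTensor p :=
  ⟨fun i => side σ (b.toFun i) (a.toFun i), by
    filter_upwards [b.eventually_one, a.eventually_ref] with i hb ha
    rw [hb, ha, map_one, Module.End.one_apply]⟩

lemma sideMul_toFun (σ : Bool) (b : LocalElem) (a : ElemTensor p) (i : ℕ) :
    (b.sideMul σ a).toFun i = side σ (b.toFun i) (a.toFun i) := rfl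

lemma one_sideMul (σ : Bool) (a : ElemTensor p) : (1 : LocalElem).sideMul σ a = a :=
  ElemTensor.ext fun i => by rw [sideMul_toFun, one_toFun, map_one, Module.End.one_apply]

lemma mul_sideMul (σ : Bool) (b c : LocalElem) (a : ElemTensor p) :
    (b * c).sideMul σ a = b.sideMul σ (c.sideMul σ a) :=
  ElemTensor.ext fun i => by
    rw [sideMul_toFun, mul_toFun, map_mul, Module.End.mul_apply, sideMul_toFun, sideMul_toFun]

lemma single_sideMul (σ : Bool) (k : ℕ) (e : M2) (a : ElemTensor p) :
    (single k e).sideMul σ a = a.update k (side σ e (a.toFun k)) := by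
  refine ElemTensor.ext fun i => ?_
  rcases eq_or_ne i k with rfl | h
  · rw [sideMul_toFun, single_toFun_self, ElemTensor.update_self]
  · rw [sideMul_toFun, single_toFun_of_ne h, map_one, Module.End.one_apply,
      ElemTensor.update_of_ne _ h]

lemma sideMul_comm (b c : LocalElem) (a : ElemTensor p) :
    b.sideMul false (c.sideMul true a) = c.sideMul true (b.sideMul false a) :=
  ElemTensor.ext fun i => LinearMap.congr_fun (side_commute (b.toFun i) (c.toFun i)) _

end LocalElem

/-- `T` is the operator of multiplication by `b` from the side `σ`, in the sense of `side`. -/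
def IsSideMul (σ : Bool) (b : LocalElem) (T : TensorH p →L[ℂ] TensorH p) : Prop :=
  ∀ a : ElemTensor p, T (tensor a) = tensor (b.sideMul σ a)

lemma isRightMul_iff (b : LocalElem) (T : TensorH p →L[ℂ] TensorH p) :
    IsRightMul b T ↔ IsSideMul true b.transpose T :=
  Iff.rfl

namespace IsSideMul

variable {σ : Bool} {b c : LocalElem} {S T : TensorH p →L[ℂ] TensorH p}

lemma unique (hS : IsSideMul σ b S) (hT : IsSideMul σ b T) : S = T :=
  TensorH.clm_ext fun a => (hS a).trans (hT a).symm

lemma mul (hS : IsSideMul σ b S) (hT : IsSideMul σ c T) : IsSideMul σ (b * c) (S * T) := fun a => by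
  rw [mul_apply_eq_comp, hT, hS, LocalElem.mul_sideMul]

lemma star (hT : IsSideMul σ b T) : IsSideMul σ (star b) (star T) := fun a =>
  TensorH.ext_inner fun c => by
    rw [ContinuousLinearMap.star_eq_adjoint, ContinuousLinearMap.adjoint_inner_right, hT,
      inner_tensor, inner_tensor]
    exact elemInner_congr fun i => hs_side σ _ _ _

lemma commute (hS : IsSideMul false b S) (hT : IsSideMul true c T) : Commute S T :=
  TensorH.clm_ext fun a => by
    rw [mul_apply_eq_comp, mul_apply_eq_comp, hS, hT, hS, hT, LocalElem.sideMul_comm]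

end IsSideMul

lemma isSideMul_one (σ : Bool) : IsSideMul (p := p) σ 1 1 := fun a => by
  rw [one_apply_eq_self, LocalElem.one_sideMul]

lemma isSideMul_siteOp (σ : Bool) (k : ℕ) (e : M2) :
    IsSideMul (p := p) σ (LocalElem.single k e) (siteOp k (side σ e)) := fun a => by
  rw [siteOp_tensor, LocalElem.single_sideMul]

lemma isSideMul_prod_siteOp (σ : Bool) (b : ℕ → M2) (n : ℕ) :
    IsSideMul (p := p) σ (LocalElem.truncate n b)
      ((List.range n).map fun i => siteOp i (side σ (b i))).prod := by
  induction n with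
  | zero => exact isSideMul_one σ
  | succ n ih =>
    rw [LocalElem.truncate_succ, List.range_succ, List.map_append, List.prod_append,
      List.map_singleton, List.prod_singleton]
    exact ih.mul (isSideMul_siteOp σ n (b n))

lemma exists_isSideMul (σ : Bool) (b : LocalElem) :
    ∃ T : TensorH p →L[ℂ] TensorH p, IsSideMul σ b T := by
  obtain ⟨n, hn⟩ := eventually_atTop.1 b.eventually_one
  exact ⟨_, LocalElem.truncate_toFun_eq hn ▸ isSideMul_prod_siteOp σ b.toFun n⟩

/-- The `W^*`-algebra generated by the multiplications from the side `σ`. -/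
def sideAlg (p : PMF Site) (σ : Bool) : Set (TensorH p →L[ℂ] TensorH p) :=
  wstarGenerated {T | ∃ b : LocalElem, IsSideMul σ b T}

lemma leftAlg_eq (p : PMF Site) : leftAlg p = sideAlg p false := rfl

lemma rightAlg_eq (p : PMF Site) : rightAlg p = sideAlg p true := by
  unfold rightAlg sideAlg
  congr 1
  ext T
  exact ⟨fun ⟨b, hb⟩ => ⟨b.transpose, hb⟩, fun ⟨b, hb⟩ => ⟨b.transpose, hb⟩⟩

/-! ### Cylinder functions in `L²(X, μ)` -/

section InfiniteProduct

variable {ι : Type*} {X : ι → Type*} [∀ i, MeasurableSpace (X i)]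

lemma integral_infinitePi_prod {𝕜 : Type*} [RCLike 𝕜] (μ : ∀ i, Measure (X i))
    [∀ i, IsProbabilityMeasure (μ i)] (I : Finset ι) {f : ∀ i, X i → 𝕜}
    (hf : ∀ i, AEStronglyMeasurable (f i) (μ i)) :
    ∫ x, ∏ i ∈ I, f i (x i) ∂Measure.infinitePi μ = ∏ i ∈ I, ∫ y, f i y ∂μ i := by
  have hmeas : AEStronglyMeasurable (fun y : ∀ i : I, X i => ∏ i : I, f i (y i))
      (Measure.pi fun i : I => μ i) :=
    Finset.aestronglyMeasurable_fun_prod _ fun i _ =>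
      (hf i).comp_quasiMeasurePreserving (Measure.quasiMeasurePreserving_eval _ i)
  have hrestrict (x : ∀ i, X i) : ∏ i : I, f i (I.restrict x i) = ∏ i ∈ I, f i (x i) :=
    Finset.prod_coe_sort I fun i => f i (x i)
  have hint := integral_restrict_infinitePi μ hmeas
  simp only [hrestrict] at hint
  rw [hint, integral_fintype_prod_eq_prod fun (i : I) => f i]
  exact Finset.prod_coe_sort I fun i => ∫ y, f i y ∂μ i

lemma ae_eq_zero_of_forall_setIntegral_squareCylinder {E : Type*} [NormedAddCommGroup E]
    [NormedSpace ℝ E] [CompleteSpace E] {μ : Measure (∀ i, X i)} {g : (∀ i, X i) → E}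
    (hg : Integrable g μ)
    (hzero : ∀ (s : Finset ι) (t : ∀ i, Set (X i)), (∀ i, MeasurableSet (t i)) →
      ∫ x in (s : Set ι).pi t, g x ∂μ = 0) : g =ᵐ[μ] 0 := by
  refine hg.ae_eq_zero_of_forall_setIntegral_eq_zero fun A hA _ => ?_
  refine MeasurableSpace.induction_on_inter
    (C := fun A _ => ∫ x in A, g x ∂μ = 0) generateFrom_squareCylinders.symm
    (isPiSystem_squareCylinders (fun _ => MeasurableSpace.isPiSystem_measurableSet) (by simp))
    (by simp) ?basic ?compl ?iUnion A hA
  case basic =>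
    rintro _ ⟨s, t, ht, rfl⟩
    exact hzero s t fun i => ht i (Set.mem_univ i)
  case compl =>
    intro A hA h
    have huniv := hzero ∅ (fun _ => Set.univ) fun _ => MeasurableSet.univ
    rw [Finset.coe_empty, Set.empty_pi, setIntegral_univ] at huniv
    rw [← huniv, ← integral_add_compl hA hg, h, zero_add]
  case iUnion =>
    intro A hdisj hmeas h
    rw [integral_iUnion hmeas hdisj hg.integrableOn]
    simp [h]

end InfiniteProduct

lemma hs_siteMatrix (f g : Site → ℂ) :
    hs (siteMatrix p f) (siteMatrix p g)
      = ∑ z, ((p z).toReal : ℂ) * ((starRingEnd ℂ) (f z) * g z) := by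
  rw [hs_apply]
  refine Finset.sum_congr rfl fun z _ => ?_
  have hsq : ((p z).toReal : ℂ) = (Real.sqrt (p z).toReal : ℂ) * (Real.sqrt (p z).toReal : ℂ) := by
    rw [← Complex.ofReal_mul, Real.mul_self_sqrt ENNReal.toReal_nonneg]
  simp only [siteMatrix, Matrix.of_apply, map_mul, Complex.conj_ofReal, hsq]
  ring

lemma coeFn_elemFun (p : PMF Site) (n : ℕ) (f : ℕ → Site → ℂ) :
    (elemFun p n f : (ℕ → Site) → ℂ) =ᵐ[prodMeasure p]
      fun x => ∏ i ∈ Finset.range n, f i (x i) :=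
  MemLp.coeFn_toLp _

lemma prod_range_truncate {M : Type*} [CommMonoid M] {n N : ℕ} (h : n ≤ N) (f : ℕ → M) :
    ∏ i ∈ Finset.range N, (if i < n then f i else 1) = ∏ i ∈ Finset.range n, f i := by
  rw [← Finset.prod_filter]
  congr 1
  ext i
  simp only [Finset.mem_filter, Finset.mem_range]
  omega

lemma elemFun_truncate (p : PMF Site) {n N : ℕ} (h : n ≤ N) (f : ℕ → Site → ℂ) :
    elemFun p N (fun i z => if i < n then f i z else 1) = elemFun p n f := by
  refine Lp.ext ?_
  filter_upwards [coeFn_elemFun p n f,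
    coeFn_elemFun p N fun i z => if i < n then f i z else 1] with x hn hN
  rw [hn, hN, prod_range_truncate h fun i => f i (x i)]

lemma elemFunTensor_truncate (p : PMF Site) {n N : ℕ} (h : n ≤ N) (f : ℕ → Site → ℂ) :
    elemFunTensor p N (fun i z => if i < n then f i z else 1) = elemFunTensor p n f := by
  refine ElemTensor.ext fun i => ?_
  by_cases hi : i < n
  · simp [elemFunTensor, hi, hi.trans_le h]
  · simp only [elemFunTensor, hi, if_false]
    exact ite_self _

lemma inner_elemFun_same_length (n : ℕ) (f f' : ℕ → Site → ℂ) :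
    ⟪elemFun p n f, elemFun p n f'⟫_ℂ
      = elemInner (elemFunTensor p n f) (elemFunTensor p n f') := by
  have hinner : (fun x => ⟪elemFun p n f x, elemFun p n f' x⟫_ℂ) =ᵐ[prodMeasure p]
      fun x => ∏ i ∈ Finset.range n, ((starRingEnd ℂ) (f i (x i)) * f' i (x i)) := by
    filter_upwards [coeFn_elemFun p n f, coeFn_elemFun p n f'] with x hf hf'
    rw [hf, hf', RCLike.inner_apply, map_prod, mul_comm, Finset.prod_mul_distrib]
  rw [L2.inner_def, integral_congr_ae hinner, prodMeasure,
    integral_infinitePi_prod _ _ (f := fun i z => (starRingEnd ℂ) (f i z) * f' i z)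
      fun i => (measurable_of_finite _).aestronglyMeasurable,
    elemInner_eq_prod _ _ n (fun i hi => if_neg hi.not_gt) fun i hi => if_neg hi.not_gt]
  refine Finset.prod_congr rfl fun i hi => ?_
  rw [PMF.integral_eq_sum]
  simp only [Complex.real_smul, elemFunTensor, Finset.mem_range.1 hi, if_true]
  exact (hs_siteMatrix _ _).symm

lemma inner_elemFun (n n' : ℕ) (f f' : ℕ → Site → ℂ) :
    ⟪elemFun p n f, elemFun p n' f'⟫_ℂ
      = elemInner (elemFunTensor p n f) (elemFunTensor p n' f') := by
  rw [← elemFun_truncate p (le_max_left n n'), ← elemFun_truncate p (le_max_right n n') f',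
    ← elemFunTensor_truncate p (le_max_left n n'),
    ← elemFunTensor_truncate p (le_max_right n n') f', inner_elemFun_same_length]

/-- The functions `f_i` with `𝔍_i f_i = a_i`, provided that no `p_{kl}` vanishes. -/
def ElemTensor.funs (a : ElemTensor p) (i : ℕ) (z : Site) : ℂ :=
  a.toFun i z.1 z.2 / (Real.sqrt (p z).toReal : ℂ)

lemma sqrt_ne_zero (hp : ∀ z, p z ≠ 0) (z : Site) : (Real.sqrt (p z).toReal : ℂ) ≠ 0 := by
  rw [Complex.ofReal_ne_zero, Real.sqrt_ne_zero ENNReal.toReal_nonneg]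
  exact (ENNReal.toReal_pos (hp z) (p.apply_ne_top z)).ne'

lemma elemFunTensor_funs (hp : ∀ z, p z ≠ 0) (a : ElemTensor p) {N : ℕ}
    (hN : ∀ i, N ≤ i → a.toFun i = refMatrix p) : elemFunTensor p N a.funs = a := by
  refine ElemTensor.ext fun i => ?_
  by_cases h : i < N
  · ext k l
    simp [elemFunTensor, h, siteMatrix, ElemTensor.funs, div_mul_cancel₀ _ (sqrt_ne_zero hp _)]
  · simp [elemFunTensor, h, hN i (not_lt.1 h)]

lemma elemFunTensor_surjective (hp : ∀ z, p z ≠ 0) :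
    Function.Surjective fun q : ℕ × (ℕ → Site → ℂ) => elemFunTensor p q.1 q.2 := fun a => by
  obtain ⟨N, hN⟩ := eventually_atTop.1 a.eventually_ref
  exact ⟨(N, a.funs), elemFunTensor_funs hp a hN⟩

lemma setIntegral_squareCylinder_eq_inner (g : L2X p) (s : Finset ℕ) (t : ℕ → Set Site) :
    ∃ (n : ℕ) (f : ℕ → Site → ℂ),
      ∫ x in (s : Set ℕ).pi t, g x ∂prodMeasure p = ⟪elemFun p n f, g⟫_ℂ := by
  classical
  obtain ⟨n, hn⟩ := s.exists_nat_subset_range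
  let f : ℕ → Site → ℂ := fun i z => if i ∈ s → z ∈ t i then 1 else 0
  refine ⟨n, f, ?_⟩
  rw [L2.inner_def, ← integral_indicator (MeasurableSet.pi s.countable_toSet fun i _ =>
    (Set.toFinite (t i)).measurableSet)]
  refine integral_congr_ae ?_
  filter_upwards [coeFn_elemFun p n f] with x hx
  rw [hx, RCLike.inner_apply]
  by_cases hmem : x ∈ (s : Set ℕ).pi t
  · have hone : ∏ i ∈ Finset.range n, f i (x i) = 1 :=
      Finset.prod_eq_one fun i _ => if_pos fun hi => hmem i hi
    rw [Set.indicator_of_mem hmem, hone, map_one, mul_one]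
  · obtain ⟨i, hi, hit⟩ : ∃ i ∈ s, x i ∉ t i := by
      simpa [Set.mem_pi] using hmem
    rw [Set.indicator_of_notMem hmem,
      Finset.prod_eq_zero (hn hi) (if_neg fun h => hit (h hi)), map_zero, mul_zero]

lemma dense_span_elemFun (p : PMF Site) :
    Dense (Submodule.span ℂ (Set.range fun q : ℕ × (ℕ → Site → ℂ) =>
      elemFun p q.1 q.2) : Set (L2X p)) := by
  rw [Submodule.dense_iff_topologicalClosure_eq_top,
    Submodule.topologicalClosure_eq_top_iff, Submodule.eq_bot_iff]
  intro g hg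
  refine Lp.eq_zero_iff_ae_eq_zero.2 (ae_eq_zero_of_forall_setIntegral_squareCylinder
    ((Lp.memLp g).integrable one_le_two) fun s t _ => ?_)
  obtain ⟨n, f, h⟩ := setIntegral_squareCylinder_eq_inner g s t
  exact h.trans (hg _ (Submodule.subset_span ⟨(n, f), rfl⟩))

lemma exists_isTensorId (hp : ∀ z, p z ≠ 0) : ∃ J : L2X p ≃ₗᵢ[ℂ] TensorH p, IsTensorId p J := by
  have hdense : Dense (Submodule.span ℂ (Set.range fun q : ℕ × (ℕ → Site → ℂ) =>
      tensor (elemFunTensor p q.1 q.2)) : Set (TensorH p)) := by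
    have hrange := (elemFunTensor_surjective hp).range_comp tensor
    exact hrange ▸ dense_span_tensor
  obtain ⟨J, hJ⟩ := exists_linearIsometryEquiv_of_inner_eq (dense_span_elemFun p) hdense
    fun q q' => by rw [inner_tensor, inner_elemFun]
  exact ⟨J, fun n f => hJ (n, f)⟩

/-! ### The Radon-Nikodym derivative -/

@[simp] lemma actX_one (x : ℕ → Site) : actX 1 1 x = x := rfl

lemma actX_actX (s₀ s₁ t₀ t₁ : FinPerm) (x : ℕ → Site) :
    actX s₀ s₁ (actX t₀ t₁ x) = actX (t₀ * s₀) (t₁ * s₁) x := rfl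

lemma measurable_site_comp {α : Type*} [MeasurableSpace α] (f : Site → α) (i : ℕ) :
    Measurable fun x : ℕ → Site => f (x i) :=
  (measurable_of_finite f).comp (measurable_pi_apply i)

lemma measurable_actX (s₀ s₁ : FinPerm) : Measurable (actX s₀ s₁) :=
  measurable_pi_lambda _ fun _ =>
    (measurable_fst.comp (measurable_pi_apply _)).prodMk
      (measurable_snd.comp (measurable_pi_apply _))

lemma exists_finset_fixed (s₀ s₁ : FinPerm) (J : Finset ℕ) :
    ∃ I : Finset ℕ, J ⊆ I ∧ ∀ i, i ∉ I → s₀.1 i = i ∧ s₁.1 i = i := by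
  classical
  have h₀ : {i | s₀.1 i ≠ i}.Finite := s₀.2
  have h₁ : {i | s₁.1 i ≠ i}.Finite := s₁.2
  refine ⟨J ∪ (h₀.toFinset ∪ h₁.toFinset), Finset.subset_union_left, fun i hi => ?_⟩
  simpa using (not_or.1 (mt Finset.mem_union.2 hi)).2

/-- The density `∏_i p((𝔞x)_i) / p(x_i)`, an explicit version of the Radon-Nikodym derivative
`rnX` when no `p_{kl}` vanishes. -/
def density (p : PMF Site) (s₀ s₁ : FinPerm) (x : ℕ → Site) : ENNReal :=
  ∏ᶠ i, p (actX s₀ s₁ x i) / p (x i)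

lemma density_eq_prod (hp : ∀ z, p z ≠ 0) {s₀ s₁ : FinPerm} {I : Finset ℕ}
    (hI : ∀ i, i ∉ I → s₀.1 i = i ∧ s₁.1 i = i) (x : ℕ → Site) :
    density p s₀ s₁ x = ∏ i ∈ I, p (actX s₀ s₁ x i) / p (x i) := by
  refine finprod_eq_prod_of_mulSupport_subset _ fun i hi => ?_
  by_contra h
  refine hi ?_
  simp only [actX, (hI i h).1, (hI i h).2, Prod.mk.eta]
  exact ENNReal.div_self (hp _) (p.apply_ne_top _)

lemma density_ne_top (hp : ∀ z, p z ≠ 0) (s₀ s₁ : FinPerm) (x : ℕ → Site) :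
    density p s₀ s₁ x ≠ ⊤ := by
  obtain ⟨I, -, hI⟩ := exists_finset_fixed s₀ s₁ ∅
  rw [density_eq_prod hp hI]
  exact ENNReal.prod_ne_top fun i _ => ENNReal.div_ne_top (p.apply_ne_top _) (hp _)

lemma density_ne_zero (hp : ∀ z, p z ≠ 0) (s₀ s₁ : FinPerm) (x : ℕ → Site) :
    density p s₀ s₁ x ≠ 0 := by
  obtain ⟨I, -, hI⟩ := exists_finset_fixed s₀ s₁ ∅
  rw [density_eq_prod hp hI]
  exact Finset.prod_ne_zero_iff.2 fun i _ => ENNReal.div_ne_zero.2 ⟨hp _, p.apply_ne_top _⟩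

lemma measurable_density (hp : ∀ z, p z ≠ 0) (s₀ s₁ : FinPerm) :
    Measurable (density p s₀ s₁) := by
  obtain ⟨I, -, hI⟩ := exists_finset_fixed s₀ s₁ ∅
  rw [show density p s₀ s₁ = _ from funext (density_eq_prod hp hI)]
  refine Finset.measurable_fun_prod _ fun i _ => Measurable.div ?_ (measurable_site_comp _ i)
  exact (measurable_site_comp (fun z => p z) i).comp (measurable_actX s₀ s₁)

lemma density_mul (hp : ∀ z, p z ≠ 0) (s₀ s₁ t₀ t₁ : FinPerm) (x : ℕ → Site) :
    density p s₀ s₁ x * density p t₀ t₁ (actX s₀ s₁ x) = density p (s₀ * t₀) (s₁ * t₁) x := by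
  obtain ⟨I, -, hI⟩ := exists_finset_fixed s₀ s₁ ∅
  obtain ⟨J, hIJ, hJ⟩ := exists_finset_fixed t₀ t₁ I
  have hI' : ∀ i, i ∉ J → s₀.1 i = i ∧ s₁.1 i = i := fun i hi => hI i fun h => hi (hIJ h)
  rw [density_eq_prod hp hI', density_eq_prod hp hJ, density_eq_prod (I := J) hp fun i hi => by
      simp [hI' i hi, hJ i hi], ← Finset.prod_mul_distrib]
  refine Finset.prod_congr rfl fun i _ => ?_
  rw [actX_actX, mul_comm, ← mul_div_assoc, ENNReal.div_mul_cancel (hp _) (p.apply_ne_top _)]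

lemma lintegral_comp_restrict (p : PMF Site) (I : Finset ℕ) (g : (I → Site) → ENNReal) :
    ∫⁻ x, g (I.restrict x) ∂prodMeasure p = ∑ K, g K * ∏ i, p (K i) := by
  rw [prodMeasure, lintegral_restrict_infinitePi _ (measurable_of_finite g), lintegral_fintype]
  simp only [Measure.pi_singleton, PMF.toMeasure_apply_singleton _ _ (measurableSet_singleton _)]

/-- The action on configurations over a finite index set of a pair of permutations of it, one for
each component. -/
def permSites {I : Type*} (σ₀ σ₁ : Equiv.Perm I) : Equiv.Perm (I → Site) where
  toFun K i := ((K (σ₀ i)).1, (K (σ₁ i)).2)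
  invFun K i := ((K (σ₀.symm i)).1, (K (σ₁.symm i)).2)
  left_inv K := by simp
  right_inv K := by simp

lemma exists_permSites_restrict {s₀ s₁ : FinPerm} {I : Finset ℕ}
    (hI : ∀ i, i ∉ I → s₀.1 i = i ∧ s₁.1 i = i) :
    ∃ e : Equiv.Perm (I → Site), ∀ x, I.restrict (actX s₀ s₁ x) = e (I.restrict x) := by
  have hmem {s : Equiv.Perm ℕ} (hs : ∀ i, i ∉ I → s i = i) (i : ℕ) : i ∈ I ↔ s i ∈ I :=
    not_iff_not.1 ⟨fun h => (hs i h).symm ▸ h, fun h => s.injective (hs _ h) ▸ h⟩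
  exact ⟨permSites (s₀.1.subtypePerm fun i => (hmem (fun i hi => (hI i hi).1) i).symm)
    (s₁.1.subtypePerm fun i => (hmem (fun i hi => (hI i hi).2) i).symm), fun x => rfl⟩

lemma lintegral_density_mul_comp_actX (hp : ∀ z, p z ≠ 0) {s₀ s₁ : FinPerm} {I : Finset ℕ}
    (hI : ∀ i, i ∉ I → s₀.1 i = i ∧ s₁.1 i = i) (g : (I → Site) → ENNReal) :
    ∫⁻ x, density p s₀ s₁ x * g (I.restrict (actX s₀ s₁ x)) ∂prodMeasure p
      = ∫⁻ x, g (I.restrict x) ∂prodMeasure p := by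
  obtain ⟨e, he⟩ := exists_permSites_restrict hI
  have hdensity (x : ℕ → Site) :
      density p s₀ s₁ x = ∏ i, p (e (I.restrict x) i) / p (I.restrict x i) := by
    rw [density_eq_prod hp hI, ← Finset.prod_coe_sort, ← he]
    rfl
  simp only [hdensity, he]
  rw [lintegral_comp_restrict p I fun K => (∏ i, p (e K i) / p (K i)) * g (e K),
    lintegral_comp_restrict]
  refine Fintype.sum_equiv e _ _ fun K => ?_
  rw [mul_right_comm, ← Finset.prod_mul_distrib, mul_comm]
  simp only [ENNReal.div_mul_cancel (hp _) (p.apply_ne_top _)]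

lemma measurePreserving_actX (hp : ∀ z, p z ≠ 0) (s₀ s₁ : FinPerm) :
    MeasurePreserving (actX s₀ s₁) ((prodMeasure p).withDensity (density p s₀ s₁))
      (prodMeasure p) := by
  refine ⟨measurable_actX _ _, Measure.eq_infinitePi _ fun s t ht => ?_⟩
  obtain ⟨I, hsI, hI⟩ := exists_finset_fixed s₀ s₁ s
  let S : Set (I → Site) := {K | ∀ i : I, i.1 ∈ s → K i ∈ t i}
  have hbox : (s : Set ℕ).pi t = I.restrict ⁻¹' S :=
    Set.ext fun x => ⟨fun h i hi => h i hi, fun h i hi => h ⟨i, hsI hi⟩ hi⟩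
  have hmeas : MeasurableSet (I.restrict ⁻¹' S : Set (ℕ → Site)) :=
    Finset.measurable_restrict I S.toFinite.measurableSet
  have hpull (x : ℕ → Site) : (actX s₀ s₁ ⁻¹' (I.restrict ⁻¹' S)).indicator (density p s₀ s₁) x
      = density p s₀ s₁ x * S.indicator 1 (I.restrict (actX s₀ s₁ x)) := by
    by_cases hx : I.restrict (actX s₀ s₁ x) ∈ S
    · rw [Set.indicator_of_mem hx, Set.indicator_of_mem (s := actX s₀ s₁ ⁻¹' _) hx,
        Pi.one_apply, mul_one]
    · rw [Set.indicator_of_notMem hx, Set.indicator_of_notMem (s := actX s₀ s₁ ⁻¹' _) hx, mul_zero]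
  rw [← Measure.infinitePi_pi (fun _ : ℕ => p.toMeasure) fun i _ => ht i, hbox,
    Measure.map_apply (measurable_actX _ _) hmeas, withDensity_apply _ (measurable_actX _ _ hmeas),
    ← lintegral_indicator (measurable_actX _ _ hmeas), ← lintegral_indicator_one hmeas,
    lintegral_congr hpull]
  exact lintegral_density_mul_comp_actX hp hI (S.indicator 1)

lemma map_actX_inv (hp : ∀ z, p z ≠ 0) (s₀ s₁ : FinPerm) :
    (prodMeasure p).map (actX s₀⁻¹ s₁⁻¹) = (prodMeasure p).withDensity (density p s₀ s₁) := by
  conv_lhs => rw [← (measurePreserving_actX hp s₀ s₁).map_eq]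
  rw [Measure.map_map (measurable_actX _ _) (measurable_actX _ _)]
  convert Measure.map_id
  funext x
  simp [actX_actX]

lemma rnX_eq_density (hp : ∀ z, p z ≠ 0) (s₀ s₁ : FinPerm) :
    rnX p s₀ s₁ =ᵐ[prodMeasure p] fun x => (density p s₀ s₁ x).toReal := by
  filter_upwards [Measure.rnDeriv_withDensity (prodMeasure p) (measurable_density hp s₀ s₁)]
    with x hx
  rw [rnX, map_actX_inv hp, hx]

/-! ### Weighted composition operators -/

section WeightedComp

variable {X 𝕜 : Type*} [MeasurableSpace X] [RCLike 𝕜] {μ : Measure X} {a : X → X} {c : X → 𝕜}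

lemma quasiMeasurePreserving_of_withDensity {r : X → ENNReal} (hr : Measurable r)
    (h₀ : ∀ x, r x ≠ 0) (ha : MeasurePreserving a (μ.withDensity r) μ) :
    Measure.QuasiMeasurePreserving a μ μ :=
  ha.quasiMeasurePreserving.mono_left
    (withDensity_absolutelyContinuous' hr.aemeasurable (Eventually.of_forall h₀))

lemma eLpNorm_mul_comp (hc : Measurable c)
    (ha : MeasurePreserving a (μ.withDensity fun x => ‖c x‖ₑ ^ 2) μ) (ζ : Lp 𝕜 2 μ) :
    eLpNorm (fun x => c x * ζ (a x)) 2 μ = eLpNorm ζ 2 μ := by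
  have hζ : Measurable fun x => ‖ζ x‖ₑ ^ 2 :=
    (Lp.stronglyMeasurable ζ).measurable.enorm.pow_const 2
  simp only [eLpNorm_eq_lintegral_rpow_enorm_toReal two_ne_zero ENNReal.ofNat_ne_top,
    ENNReal.toReal_ofNat, ENNReal.rpow_ofNat, enorm_mul, mul_pow]
  have hcomp : ∫⁻ x, ‖c x‖ₑ ^ 2 * ‖ζ (a x)‖ₑ ^ 2 ∂μ = ∫⁻ x, ‖ζ x‖ₑ ^ 2 ∂μ :=
    (lintegral_withDensity_eq_lintegral_mul _ (hc.enorm.pow_const 2)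
      (hζ.comp ha.measurable)).symm.trans (ha.lintegral_comp hζ)
  rw [hcomp]

lemma exists_weightedComp (hc : Measurable c) (h₀ : ∀ x, c x ≠ 0)
    (ha : MeasurePreserving a (μ.withDensity fun x => ‖c x‖ₑ ^ 2) μ) :
    ∃ W : Lp 𝕜 2 μ →ₗᵢ[𝕜] Lp 𝕜 2 μ, ∀ ζ : Lp 𝕜 2 μ, W ζ =ᵐ[μ] fun x => c x * ζ (a x) := by
  have hq := quasiMeasurePreserving_of_withDensity (hc.enorm.pow_const 2) (by simp [h₀]) ha
  have hmem (ζ : Lp 𝕜 2 μ) : MemLp (fun x => c x * ζ (a x)) 2 μ :=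
    ⟨hc.aestronglyMeasurable.mul
      ((Lp.stronglyMeasurable ζ).comp_measurable ha.measurable).aestronglyMeasurable,
      (eLpNorm_mul_comp hc ha ζ).trans_lt (Lp.eLpNorm_lt_top ζ)⟩
  refine ⟨⟨⟨⟨fun ζ => (hmem ζ).toLp _, fun ζ η => Lp.ext ?_⟩, fun r ζ => Lp.ext ?_⟩, fun ζ => ?_⟩,
    fun ζ => (hmem ζ).coeFn_toLp⟩
  · filter_upwards [(hmem (ζ + η)).coeFn_toLp, (hmem ζ).coeFn_toLp, (hmem η).coeFn_toLp,
      Lp.coeFn_add ((hmem ζ).toLp _) ((hmem η).toLp _),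
      hq.ae (Lp.coeFn_add ζ η)] with x h₁ h₂ h₃ h₄ h₅
    rw [h₁, h₄, Pi.add_apply, h₂, h₃, h₅, Pi.add_apply, mul_add]
  · filter_upwards [(hmem (r • ζ)).coeFn_toLp, (hmem ζ).coeFn_toLp,
      Lp.coeFn_smul r ((hmem ζ).toLp _), hq.ae (Lp.coeFn_smul r ζ)] with x h₁ h₂ h₃ h₄
    rw [RingHom.id_apply, h₁, h₃, Pi.smul_apply, h₂, h₄, Pi.smul_apply, mul_smul_comm]
  · change ‖(hmem ζ).toLp _‖ = ‖ζ‖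
    rw [Lp.norm_toLp, eLpNorm_mul_comp hc ha, Lp.norm_def]

end WeightedComp

/-! ### The representation of `G × G` -/

lemma exists_unitary_monoidHom {G 𝕜 E : Type*} [Group G] [RCLike 𝕜] [NormedAddCommGroup E]
    [InnerProductSpace 𝕜 E] [CompleteSpace E] (W : G → E →ₗᵢ[𝕜] E)
    (hW : ∀ g h x, W (g * h) x = W g (W h x)) :
    ∃ U : G →* unitary (E →L[𝕜] E), ∀ g x, (U g : E →L[𝕜] E) x = W g x := by
  have hone (x : E) : W 1 x = x := (W 1).injective (by rw [← hW, one_mul])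
  have hsurj (g : G) : Function.Surjective (W g) := fun x =>
    ⟨W g⁻¹ x, by rw [← hW, mul_inv_cancel, hone]⟩
  let U : G →* E ≃ₗᵢ[𝕜] E :=
    { toFun g := LinearIsometryEquiv.ofSurjective (W g) (hsurj g)
      map_one' := LinearIsometryEquiv.ext hone
      map_mul' g h := LinearIsometryEquiv.ext (hW g h) }
  exact ⟨Unitary.linearIsometryEquiv.symm.toMonoidHom.comp U, fun g x => rfl⟩

/-- The character `γ ↦ (-1)^{∑ᵢ γᵢ nᵢ}` of the finitely supported sequences in `ℤ/2`. -/
def signChar (n : ℕ → ℕ) (γ : ℕ →₀ ZMod 2) : ℂ := γ.prod fun i g => (-1 : ℂ) ^ (g.val * n i)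

lemma signChar_add (n : ℕ → ℕ) (γ δ : ℕ →₀ ZMod 2) :
    signChar n (γ + δ) = signChar n γ * signChar n δ := by
  have hparity : ∀ g h : ZMod 2, (g + h).val % 2 = (g.val + h.val) % 2 := by decide
  refine Finsupp.prod_add_index' (fun i => by simp) fun i g h => ?_
  rw [pow_mul, pow_mul, pow_mul, ← mul_pow, ← pow_add]
  exact congrArg (· ^ n i) (neg_one_pow_congr (by simp only [Nat.even_iff, hparity]))

lemma signChar_permAction (n : ℕ → ℕ) (s : FinPerm) (γ : GammaInf) :
    signChar n (permAction s γ).toAdd = signChar (fun i => n (s.1 i)) γ.toAdd :=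
  Finsupp.prod_equivMapDomain _ _ _

lemma neg_one_pow_signExp (γ₀ γ₁ : ℕ →₀ ZMod 2) (x : ℕ → Site) :
    (-1 : ℂ) ^ signExp γ₀ γ₁ x
      = signChar (fun i => ((x i).1 : ℕ)) γ₀ * signChar (fun i => ((x i).2 : ℕ)) γ₁ := by
  rw [signExp, pow_add, ← Finset.prod_pow_eq_pow_sum, ← Finset.prod_pow_eq_pow_sum]
  rfl

/-- The cocycle of `π_μ`: the function `c` for which `π_μ(g)` is `ζ ↦ c · (ζ ∘ 𝔞)`, where `𝔞`
is the action of the permutation part of `g`. -/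
def multiplier (p : PMF Site) (g : Wreath × Wreath) (x : ℕ → Site) : ℂ :=
  (-1) ^ signExp g.1.left.toAdd g.2.left.toAdd x *
    (Real.sqrt (density p g.1.right g.2.right x).toReal : ℂ)

lemma multiplier_mul (hp : ∀ z, p z ≠ 0) (g h : Wreath × Wreath) (x : ℕ → Site) :
    multiplier p (g * h) x
      = multiplier p g x * multiplier p h (actX g.1.right g.2.right x) := by
  simp only [multiplier, Prod.fst_mul, Prod.snd_mul, SemidirectProduct.mul_left,
    SemidirectProduct.mul_right, neg_one_pow_signExp, toAdd_mul, signChar_add,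
    signChar_permAction, ← density_mul hp, ENNReal.toReal_mul,
    Real.sqrt_mul ENNReal.toReal_nonneg, Complex.ofReal_mul, actX]
  ring

lemma multiplier_ne_zero (hp : ∀ z, p z ≠ 0) (g : Wreath × Wreath) (x : ℕ → Site) :
    multiplier p g x ≠ 0 := by
  refine mul_ne_zero (pow_ne_zero _ (neg_ne_zero.2 one_ne_zero)) ?_
  rw [Complex.ofReal_ne_zero, Real.sqrt_ne_zero ENNReal.toReal_nonneg]
  exact (ENNReal.toReal_pos (density_ne_zero hp _ _ _) (density_ne_top hp _ _ _)).ne'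

lemma measurable_multiplier (hp : ∀ z, p z ≠ 0) (g : Wreath × Wreath) :
    Measurable (multiplier p g) := by
  have hsum (γ : ℕ →₀ ZMod 2) (f : Site → ℕ) :
      Measurable fun x : ℕ → Site => ∑ i ∈ γ.support, (γ i).val * f (x i) :=
    Finset.measurable_fun_sum _ fun i _ => measurable_site_comp (fun z => (γ i).val * f z) i
  refine ((measurable_of_countable fun n : ℕ => (-1 : ℂ) ^ n).comp
    ((hsum g.1.left.toAdd fun z => z.1).add (hsum g.2.left.toAdd fun z => z.2))).mul ?_
  exact Complex.measurable_ofReal.comp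
    (Real.continuous_sqrt.measurable.comp (measurable_density hp _ _).ennreal_toReal)

lemma enorm_multiplier_sq (hp : ∀ z, p z ≠ 0) (g : Wreath × Wreath) (x : ℕ → Site) :
    ‖multiplier p g x‖ₑ ^ 2 = density p g.1.right g.2.right x := by
  have hnorm : ‖multiplier p g x‖ = Real.sqrt (density p g.1.right g.2.right x).toReal := by
    rw [multiplier, norm_mul, norm_pow, norm_neg, norm_one, one_pow, one_mul, Complex.norm_real,
      Real.norm_of_nonneg (Real.sqrt_nonneg _)]
  rw [← ofReal_norm, hnorm, ← ENNReal.ofReal_pow (Real.sqrt_nonneg _),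
    Real.sq_sqrt ENNReal.toReal_nonneg, ENNReal.ofReal_toReal (density_ne_top hp _ _ _)]

lemma quasiMeasurePreserving_actX (hp : ∀ z, p z ≠ 0) (s₀ s₁ : FinPerm) :
    Measure.QuasiMeasurePreserving (actX s₀ s₁) (prodMeasure p) (prodMeasure p) :=
  quasiMeasurePreserving_of_withDensity (measurable_density hp _ _) (density_ne_zero hp _ _)
    (measurePreserving_actX hp _ _)

lemma exists_isRepMu (hp : ∀ z, p z ≠ 0) :
    ∃ π : Wreath × Wreath →* unitary (L2X p →L[ℂ] L2X p), IsRepMu p π := by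
  have hW (g : Wreath × Wreath) := exists_weightedComp (measurable_multiplier hp g)
    (multiplier_ne_zero hp g) (by
      simpa only [enorm_multiplier_sq hp] using measurePreserving_actX hp g.1.right g.2.right)
  choose W hW using hW
  have hmul (g h : Wreath × Wreath) (ζ : L2X p) : W (g * h) ζ = W g (W h ζ) := by
    refine Lp.ext ?_
    filter_upwards [hW (g * h) ζ, hW g (W h ζ),
      (quasiMeasurePreserving_actX hp g.1.right g.2.right).ae (hW h ζ)] with x h₁ h₂ h₃
    rw [h₁, h₂, h₃, multiplier_mul hp, mul_assoc]
    rfl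
  obtain ⟨π, hπ⟩ := exists_unitary_monoidHom W hmul
  refine ⟨π, fun s₀ s₁ ζ => ?_, fun γ₀ γ₁ ζ => ?_⟩
  · filter_upwards [hW (permG s₀, permG s₁) ζ, rnX_eq_density hp s₀ s₁] with x h₁ h₂
    rw [hπ, h₁, h₂]
    simp [multiplier, permG, signExp]
  · filter_upwards [hW (gammaG γ₀, gammaG γ₁) ζ] with x h₁
    have hdensity : density p 1 1 x = 1 := by
      rw [density_eq_prod (I := ∅) hp fun i _ => ⟨rfl, rfl⟩, Finset.prod_empty]
    rw [hπ, h₁]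
    simp [multiplier, gammaG, hdensity]

/-! ### The representation in the tensor picture -/

/-- The two embeddings `G → G × G`, indexed by the side on which the image acts. -/
def sideEmb : Bool → Wreath →* Wreath × Wreath
  | false => MonoidHom.inl Wreath Wreath
  | true => MonoidHom.inr Wreath Wreath

/-- The coordinate of a site on the side `σ`: the row index for `false`, the column index
for `true`. -/
def coord : Bool → Site → Fin 2
  | false => Prod.fst
  | true => Prod.snd

/-- The site `z` with its coordinate on the side `σ` replaced by that of `w`. -/
def exchange : Bool → Site → Site → Site
  | false, z, w => (w.1, z.2)
  | true, z, w => (z.1, w.2)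

lemma exchange_self (σ : Bool) (z : Site) : exchange σ z z = z := by
  cases σ <;> rfl

/-- The action of a permutation on the coordinates of the side `σ`. -/
def sideAct (σ : Bool) (s : FinPerm) (x : ℕ → Site) (i : ℕ) : Site :=
  exchange σ (x i) (x (s.1 i))

lemma quasiMeasurePreserving_sideAct (hp : ∀ z, p z ≠ 0) (σ : Bool) (s : FinPerm) :
    Measure.QuasiMeasurePreserving (sideAct σ s) (prodMeasure p) (prodMeasure p) := by
  cases σ
  · exact quasiMeasurePreserving_actX hp s 1
  · exact quasiMeasurePreserving_actX hp 1 s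

lemma ofReal_sqrt_density (hp : ∀ z, p z ≠ 0) {s₀ s₁ : FinPerm} {I : Finset ℕ}
    (hI : ∀ i, i ∉ I → s₀.1 i = i ∧ s₁.1 i = i) (x : ℕ → Site) :
    (Real.sqrt (density p s₀ s₁ x).toReal : ℂ)
      = ∏ i ∈ I, (Real.sqrt (p (actX s₀ s₁ x i)).toReal : ℂ) /
        (Real.sqrt (p (x i)).toReal : ℂ) := by
  rw [density_eq_prod hp hI, ENNReal.toReal_prod,
    Real.sqrt_prod I fun i _ => ENNReal.toReal_nonneg, Complex.ofReal_prod]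
  refine Finset.prod_congr rfl fun i _ => ?_
  rw [ENNReal.toReal_div, Real.sqrt_div' _ ENNReal.toReal_nonneg, Complex.ofReal_div]

section Conjugation

variable {π : Wreath × Wreath →* unitary (L2X p →L[ℂ] L2X p)}

lemma IsRepMu.coeFn_perm (hp : ∀ z, p z ≠ 0) (hπ : IsRepMu p π) (σ : Bool) (s : FinPerm)
    {I : Finset ℕ} (hI : ∀ i, i ∉ I → s.1 i = i) (ζ : L2X p) :
    (π (sideEmb σ (permG s)) : L2X p →L[ℂ] L2X p) ζ =ᵐ[prodMeasure p]
      fun x => (∏ i ∈ I, (Real.sqrt (p (sideAct σ s x i)).toReal : ℂ) /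
        (Real.sqrt (p (x i)).toReal : ℂ)) * ζ (sideAct σ s x) := by
  have hone : permG 1 = 1 := map_one _
  cases σ
  · filter_upwards [hπ.perm s 1 ζ, rnX_eq_density hp s 1] with x hx hdensity
    rw [hdensity, ofReal_sqrt_density hp fun i hi => ⟨hI i hi, rfl⟩, hone] at hx
    exact hx
  · filter_upwards [hπ.perm 1 s ζ, rnX_eq_density hp 1 s] with x hx hdensity
    rw [hdensity, ofReal_sqrt_density hp fun i hi => ⟨rfl, hI i hi⟩, hone] at hx
    exact hx

lemma IsRepMu.coeFn_gamma (hπ : IsRepMu p π) (σ : Bool) (γ : ℕ →₀ ZMod 2) (ζ : L2X p) :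
    (π (sideEmb σ (gammaG γ)) : L2X p →L[ℂ] L2X p) ζ =ᵐ[prodMeasure p]
      fun x => signChar (fun i => (coord σ (x i) : ℕ)) γ * ζ x := by
  have hzero : gammaG 0 = 1 := map_one _
  have hone (n : ℕ → ℕ) : signChar n 0 = 1 := Finsupp.prod_zero_index
  cases σ
  · filter_upwards [hπ.gamma γ 0 ζ] with x hx
    rw [hzero, neg_one_pow_signExp, hone, mul_one] at hx
    exact hx
  · filter_upwards [hπ.gamma 0 γ ζ] with x hx
    rw [hzero, neg_one_pow_signExp, hone, one_mul] at hx
    exact hx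

variable {J : L2X p ≃ₗᵢ[ℂ] TensorH p}

lemma IsTensorId.coeFn_symm_tensor (hp : ∀ z, p z ≠ 0) (hJ : IsTensorId p J) (a : ElemTensor p)
    {N : ℕ} (hN : ∀ i, N ≤ i → a.toFun i = refMatrix p) :
    J.symm (tensor a) =ᵐ[prodMeasure p] fun x => ∏ i ∈ Finset.range N, a.funs i (x i) := by
  have hsymm : J.symm (tensor a) = elemFun p N a.funs := by
    rw [LinearIsometryEquiv.symm_apply_eq, hJ, elemFunTensor_funs hp a hN]
  exact hsymm ▸ coeFn_elemFun p N a.funs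

lemma sum_side_single (σ : Bool) (A B : M2) (z w : Site) :
    ∑ q : Fin 2 × Fin 2, side σ (Matrix.single q.1 q.2 1) A z.1 z.2 *
      side σ (Matrix.single q.2 q.1 1) B w.1 w.2
      = A (exchange σ z w).1 (exchange σ z w).2 * B (exchange σ w z).1 (exchange σ w z).2 := by
  obtain ⟨z₀, z₁⟩ := z
  obtain ⟨w₀, w₁⟩ := w
  rw [Fintype.sum_prod_type]
  cases σ <;> fin_cases z₀ <;> fin_cases z₁ <;> fin_cases w₀ <;> fin_cases w₁ <;>
    simp [exchange, Matrix.mul_apply, Matrix.single_apply]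

lemma ElemTensor.sum_prod_update_side_single (a : ElemTensor p) (σ : Bool) {k l N : ℕ}
    (hkl : k ≠ l) (hk : k < N) (hl : l < N) (x : ℕ → Site) :
    ∑ q : Fin 2 × Fin 2, ∏ i ∈ Finset.range N,
      ((a.update l (side σ (Matrix.single q.2 q.1 1) (a.toFun l))).update k
        (side σ (Matrix.single q.1 q.2 1) (a.toFun k))).toFun i (x i).1 (x i).2
      = ∏ i ∈ Finset.range N,
        a.toFun i (sideAct σ (transp k l) x i).1 (sideAct σ (transp k l) x i).2 := by
  have hsplit (f : ℕ → ℂ) : ∏ i ∈ Finset.range N, f i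
      = f k * f l * ∏ i ∈ ((Finset.range N).erase k).erase l, f i := by
    rw [mul_assoc, Finset.mul_prod_erase _ f
      (Finset.mem_erase.2 ⟨hkl.symm, Finset.mem_range.2 hl⟩),
      Finset.mul_prod_erase _ f (Finset.mem_range.2 hk)]
  have hrest (q : Fin 2 × Fin 2) : ∏ i ∈ ((Finset.range N).erase k).erase l,
      ((a.update l (side σ (Matrix.single q.2 q.1 1) (a.toFun l))).update k
        (side σ (Matrix.single q.1 q.2 1) (a.toFun k))).toFun i (x i).1 (x i).2
      = ∏ i ∈ ((Finset.range N).erase k).erase l,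
        a.toFun i (sideAct σ (transp k l) x i).1 (sideAct σ (transp k l) x i).2 := by
    refine Finset.prod_congr rfl fun i hi => ?_
    obtain ⟨hil, hik, -⟩ : i ≠ l ∧ i ≠ k ∧ i ∈ Finset.range N := by simpa using hi
    rw [update_of_ne _ hik, update_of_ne _ hil, sideAct, transp,
      Equiv.swap_apply_of_ne_of_ne hik hil, exchange_self]
  simp only [hsplit, hrest]
  rw [← Finset.sum_mul]
  simp only [update_self, update_of_ne _ hkl.symm, sideAct, transp, Equiv.swap_apply_left,
    Equiv.swap_apply_right]
  rw [sum_side_single]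

lemma IsTensorId.conj_transp (hp : ∀ z, p z ≠ 0) (hJ : IsTensorId p J) (hπ : IsRepMu p π)
    (σ : Bool) {k l : ℕ} (hkl : k ≠ l) :
    J.conjStarAlgEquiv (π (sideEmb σ (permG (transp k l))))
      = ∑ q : Fin 2 × Fin 2, siteOp k (side σ (Matrix.single q.1 q.2 1)) *
          siteOp l (side σ (Matrix.single q.2 q.1 1)) := by
  refine TensorH.clm_ext fun a => ?_
  obtain ⟨N, hN⟩ := eventually_atTop.1
    (a.eventually_ref.and ((eventually_gt_atTop k).and (eventually_gt_atTop l)))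
  obtain ⟨-, hk, hl⟩ := hN N le_rfl
  have ha (i : ℕ) (hi : N ≤ i) : a.toFun i = refMatrix p := (hN i hi).1
  let b (q : Fin 2 × Fin 2) : ElemTensor p :=
    (a.update l (side σ (Matrix.single q.2 q.1 1) (a.toFun l))).update k
      (side σ (Matrix.single q.1 q.2 1) (a.toFun k))
  have hb (q : Fin 2 × Fin 2) (i : ℕ) (hi : N ≤ i) : (b q).toFun i = refMatrix p := by
    rw [ElemTensor.update_of_ne _ (hk.trans_le hi).ne',
      ElemTensor.update_of_ne _ (hl.trans_le hi).ne', ha i hi]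
  have hsum : (∑ q : Fin 2 × Fin 2, siteOp k (side σ (Matrix.single q.1 q.2 1)) *
      siteOp l (side σ (Matrix.single q.2 q.1 1)) : TensorH p →L[ℂ] TensorH p) (tensor a)
        = ∑ q, tensor (b q) := by
    simp [siteOp_tensor, hkl, b]
  have hfix (i : ℕ) (hi : i ∉ Finset.range N) : (transp k l).1 i = i := by
    have hi := not_lt.1 (mt Finset.mem_range.2 hi)
    exact Equiv.swap_apply_of_ne_of_ne (hk.trans_le hi).ne' (hl.trans_le hi).ne'
  rw [hsum, LinearIsometryEquiv.conjStarAlgEquiv_apply_apply, ← LinearIsometryEquiv.eq_symm_apply,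
    map_sum]
  refine Lp.ext ?_
  filter_upwards [hπ.coeFn_perm hp σ (transp k l) hfix (J.symm (tensor a)),
    (quasiMeasurePreserving_sideAct hp σ (transp k l)).ae (hJ.coeFn_symm_tensor hp a ha),
    Lp.coeFn_fun_finsetSum Finset.univ (fun q => J.symm (tensor (b q))),
    ae_all_iff.2 fun q => hJ.coeFn_symm_tensor hp (b q) (hb q)] with x h₁ h₂ h₃ h₄
  rw [h₁, h₂, h₃]
  simp only [h₄, ElemTensor.funs, Finset.prod_div_distrib]
  rw [← Finset.sum_div, a.sum_prod_update_side_single σ hkl hk hl, div_mul_div_comm, mul_comm,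
    mul_div_mul_right _ _ (Finset.prod_ne_zero_iff.2 fun i _ => sqrt_ne_zero hp _)]

/-- The diagonal matrix `diag(1, (-1)^g)`, the value at `g` of the sign character on one tensor
factor. -/
def signMatrix (g : ZMod 2) : M2 := Matrix.diagonal fun j => (-1) ^ (g.val * (j : ℕ))

lemma side_signMatrix (σ : Bool) (g : ZMod 2) (A : M2) (z : Site) :
    side σ (signMatrix g) A z.1 z.2 = (-1) ^ (g.val * (coord σ z : ℕ)) * A z.1 z.2 := by
  cases σ
  · simp [signMatrix, coord, Matrix.diagonal_mul]
  · simp [signMatrix, coord, Matrix.mul_diagonal, mul_comm]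

/-- The local element `diag(1, (-1)^{γ₀}) ⊗ diag(1, (-1)^{γ₁}) ⊗ ⋯`. -/
def signElem (γ : ℕ →₀ ZMod 2) : LocalElem :=
  ⟨fun i => signMatrix (γ i), by
    have hγ : ∀ᶠ i in cofinite, γ i = 0 := γ.hasFiniteSupport
    filter_upwards [Nat.cofinite_eq_atTop ▸ hγ] with i hi
    simp [hi, signMatrix]⟩

lemma IsTensorId.conj_gamma (hp : ∀ z, p z ≠ 0) (hJ : IsTensorId p J) (hπ : IsRepMu p π)
    (σ : Bool) (γ : ℕ →₀ ZMod 2) :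
    IsSideMul σ (signElem γ) (J.conjStarAlgEquiv (π (sideEmb σ (gammaG γ)))) := fun a => by
  obtain ⟨n, hγ⟩ := γ.support.exists_nat_subset_range
  obtain ⟨N, hN⟩ := eventually_atTop.1 ((eventually_ge_atTop n).and
    (a.eventually_ref.and ((signElem γ).sideMul σ a).eventually_ref))
  rw [LinearIsometryEquiv.conjStarAlgEquiv_apply_apply, ← LinearIsometryEquiv.eq_symm_apply]
  refine Lp.ext ?_
  filter_upwards [hπ.coeFn_gamma σ γ (J.symm (tensor a)),
    hJ.coeFn_symm_tensor hp a fun i hi => (hN i hi).2.1,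
    hJ.coeFn_symm_tensor hp ((signElem γ).sideMul σ a) fun i hi => (hN i hi).2.2] with x h₁ h₂ h₃
  rw [h₁, h₂, h₃, signChar, Finsupp.prod_of_support_subset γ
    (hγ.trans (Finset.range_subset_range.2 (hN N le_rfl).1)) _ (by simp),
    ← Finset.prod_mul_distrib]
  refine Finset.prod_congr rfl fun i _ => ?_
  rw [ElemTensor.funs, ElemTensor.funs, LocalElem.sideMul_toFun, signElem, side_signMatrix,
    mul_div_assoc]

end Conjugation

/-! ### Averages of vectors and operators -/

section Averages

variable {𝕜 ι H : Type*} [RCLike 𝕜] [NormedAddCommGroup H] [InnerProductSpace 𝕜 H]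

lemma norm_sum_sq_of_orthogonal {y : ι → H} (hy : Pairwise fun k l => ⟪y k, y l⟫_𝕜 = 0)
    (s : Finset ι) : ‖∑ l ∈ s, y l‖ ^ 2 = ∑ l ∈ s, ‖y l‖ ^ 2 := by
  refine RCLike.ofReal_injective (K := 𝕜) ?_
  push_cast
  rw [← inner_self_eq_norm_sq_to_K, sum_inner]
  refine Finset.sum_congr rfl fun k hk => ?_
  rw [inner_sum, Finset.sum_eq_single_of_mem k hk fun l _ hl => hy hl.symm,
    inner_self_eq_norm_sq_to_K]

lemma tendsto_average_of_tendsto {y : ℕ → H} {v : H} (hy : Tendsto y atTop (𝓝 v)) :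
    Tendsto (fun n : ℕ => (n : 𝕜)⁻¹ • ∑ l ∈ Finset.range n, y l) atTop (𝓝 v) := by
  let _ : NormedSpace ℝ H := NormedSpace.restrictScalars ℝ 𝕜 H
  refine hy.cesaro_smul.congr fun n => ?_
  rw [RCLike.real_smul_eq_coe_smul (K := 𝕜), RCLike.ofReal_inv, RCLike.ofReal_natCast]

lemma tendsto_average_of_eventuallyEq {x y : ℕ → H} {v : H} (hxy : x =ᶠ[atTop] y)
    (hy : Tendsto (fun n : ℕ => (n : 𝕜)⁻¹ • ∑ l ∈ Finset.range n, y l) atTop (𝓝 v)) :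
    Tendsto (fun n : ℕ => (n : 𝕜)⁻¹ • ∑ l ∈ Finset.range n, x l) atTop (𝓝 v) := by
  have hsub : Tendsto (x - y) atTop (𝓝 0) :=
    tendsto_const_nhds.congr' (hxy.mono fun l hl => (sub_eq_zero.2 hl).symm)
  have hsum := (tendsto_average_of_tendsto (𝕜 := 𝕜) hsub).add hy
  simpa only [Pi.sub_apply, Finset.sum_sub_distrib, smul_sub, sub_add_cancel, zero_add] using hsum

lemma tendsto_average_of_orthogonal {y : ℕ → H} {C : ℝ}
    (hy : Pairwise fun k l => ⟪y k, y l⟫_𝕜 = 0) (hC : ∀ l, ‖y l‖ ≤ C) :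
    Tendsto (fun n : ℕ => (n : 𝕜)⁻¹ • ∑ l ∈ Finset.range n, y l) atTop (𝓝 0) := by
  have hsq (n : ℕ) : ‖(n : 𝕜)⁻¹ • ∑ l ∈ Finset.range n, y l‖ ^ 2 ≤ C ^ 2 * (n : ℝ)⁻¹ := by
    have hsum : ∑ l ∈ Finset.range n, ‖y l‖ ^ 2 ≤ n * C ^ 2 := by
      simpa using Finset.sum_le_card_nsmul (Finset.range n) (fun l => ‖y l‖ ^ 2) (C ^ 2)
        fun l _ => pow_le_pow_left₀ (norm_nonneg _) (hC l) 2
    calc ‖(n : 𝕜)⁻¹ • ∑ l ∈ Finset.range n, y l‖ ^ 2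
        = ((n : ℝ)⁻¹) ^ 2 * ∑ l ∈ Finset.range n, ‖y l‖ ^ 2 := by
          rw [norm_smul, mul_pow, norm_sum_sq_of_orthogonal hy, norm_inv, RCLike.norm_natCast]
      _ ≤ ((n : ℝ)⁻¹) ^ 2 * (n * C ^ 2) := by gcongr
      _ = C ^ 2 * (n : ℝ)⁻¹ := by field_simp
  have hlim : Tendsto (fun n : ℕ => C ^ 2 * (n : ℝ)⁻¹) atTop (𝓝 0) := by
    simpa using (tendsto_inv_atTop_nhds_zero_nat (𝕜 := ℝ)).const_mul (C ^ 2)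
  have hsqrt := (squeeze_zero (fun n => sq_nonneg _) hsq hlim).sqrt
  simp only [Real.sqrt_sq (norm_nonneg _), Real.sqrt_zero] at hsqrt
  exact tendsto_zero_iff_norm_tendsto_zero.2 hsqrt

end Averages

section StrongConvergence

variable {𝕜 E F : Type*} [RCLike 𝕜] [NormedAddCommGroup E] [NormedSpace 𝕜 E]
  [NormedAddCommGroup F] [NormedSpace 𝕜 F]

lemma norm_average_le {U : ℕ → E →L[𝕜] F} {C : ℝ} (hC : 0 ≤ C) (hU : ∀ l, ‖U l‖ ≤ C) (n : ℕ) :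
    ‖(n : 𝕜)⁻¹ • ∑ l ∈ Finset.range n, U l‖ ≤ C := by
  rw [norm_smul, norm_inv, RCLike.norm_natCast]
  refine inv_mul_le_of_le_mul₀ n.cast_nonneg hC ?_
  simpa using norm_sum_le_of_le (Finset.range n) fun l _ => hU l

lemma tendsto_of_dense_span {ι : Type*} {l : Filter ι} {U : ι → E →L[𝕜] F} {T : E →L[𝕜] F}
    {C : ℝ} (hU : ∀ i, ‖U i‖ ≤ C) {S : Set E} (hS : Dense (Submodule.span 𝕜 S : Set E))
    (h : ∀ v ∈ S, Tendsto (fun i => U i v) l (𝓝 (T v))) (v : E) :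
    Tendsto (fun i => U i v) l (𝓝 (T v)) := by
  have hbounded : ∃ C, ∀ i, ‖U i‖ ≤ C := ⟨C, hU⟩
  have hequi : Equicontinuous ((↑) ∘ U) :=
    ((NormedSpace.equicontinuous_TFAE U).out 5 1).1 hbounded
  have hspan (v) (hv : v ∈ Submodule.span 𝕜 S) : Tendsto (fun i => U i v) l (𝓝 (T v)) := by
    induction hv using Submodule.span_induction with
    | mem v hv => exact h v hv
    | zero => simpa only [map_zero] using tendsto_const_nhds
    | add u v _ _ hu hv => simpa only [map_add] using hu.add hv
    | smul c u _ hu => simpa only [map_smul] using hu.const_smul c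
  exact (hequi.isClosed_setOfPred_tendsto T.continuous).closure_subset_iff.2 hspan (hS v)

end StrongConvergence

lemma tendsto_average_tensor_update {u : M2} (hu : hs (refMatrix p) u = 0) (a : ElemTensor p) :
    Tendsto (fun n : ℕ => (n : ℂ)⁻¹ • ∑ l ∈ Finset.range n, tensor (a.update l u)) atTop
      (𝓝 0) := by
  obtain ⟨N, hN⟩ := eventually_atTop.1 a.eventually_ref
  let y : ℕ → TensorH p := (Set.Ici N).indicator fun l => tensor (a.update l u)
  have hinner {k l : ℕ} (hl : N ≤ l) (hkl : k ≠ l) :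
      ⟪tensor (a.update k u), tensor (a.update l u)⟫_ℂ = 0 := by
    rw [inner_tensor, elemInner_factor _ _ l, ElemTensor.update_self,
      ElemTensor.update_of_ne _ hkl.symm, hN l hl, hu, zero_mul]
  have hy : Pairwise fun k l => ⟪y k, y l⟫_ℂ = 0 := fun k l hkl => by
    by_cases hk : N ≤ k <;> by_cases hl : N ≤ l <;> simp [y, hk, hl, hinner, hkl]
  have hnorm (l : ℕ) : ‖y l‖ ≤ Real.sqrt (hs u u * elemInner a a).re := by
    by_cases hl : N ≤ l
    · have ha : a.update l (refMatrix p) = a := hN l hl ▸ a.update_eq_self l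
      simp only [y, Set.indicator_of_mem (Set.mem_Ici.2 hl)]
      rw [@norm_eq_sqrt_re_inner ℂ, inner_tensor, elemInner_factor _ _ l, ElemTensor.update_self,
        ElemTensor.update_update, ha, RCLike.re_to_complex]
    · simp only [y, Set.indicator_of_notMem (mt Set.mem_Ici.1 hl), norm_zero, Real.sqrt_nonneg]
  refine tendsto_average_of_eventuallyEq ?_ (tendsto_average_of_orthogonal hy hnorm)
  filter_upwards [eventually_ge_atTop N] with l hl
  simp only [y, Set.indicator_of_mem (Set.mem_Ici.2 hl)]

/-- The weak law of large numbers for the product vector state. -/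
lemma tendsto_average_siteOp (t : Module.End ℂ M2) (a : ElemTensor p) :
    Tendsto (fun n : ℕ => (n : ℂ)⁻¹ • ∑ l ∈ Finset.range n, siteOp l t (tensor a)) atTop
      (𝓝 (hs (refMatrix p) (t (refMatrix p)) • tensor a)) := by
  set c := hs (refMatrix p) (t (refMatrix p)) with hc
  set u : M2 := t (refMatrix p) - c • refMatrix p with hu
  have hu0 : hs (refMatrix p) u = 0 := by
    have hunit : hs (refMatrix p) (refMatrix p) = 1 := trace_refMatrix p
    rw [hu, sub_eq_add_neg, ← neg_smul, hs_add_right, hs_smul_right, hunit, ← hc]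
    ring
  have hsum : (siteOp · t (tensor a)) =ᶠ[atTop] fun l => tensor (a.update l u) + c • tensor a := by
    filter_upwards [a.eventually_ref] with l hl
    rw [siteOp_tensor, hl, ← slot_apply, ← slot_apply, hu, map_sub, map_smul,
      slot_apply a l (refMatrix p), ← hl, a.update_eq_self, sub_add_cancel]
  refine tendsto_average_of_eventuallyEq hsum ?_
  simp only [Finset.sum_add_distrib, smul_add]
  simpa only [zero_add] using (tendsto_average_tensor_update hu0 a).add
    (tendsto_average_of_tendsto (𝕜 := ℂ) tendsto_const_nhds)

/-! ### The Okounkov operators -/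

/-- The matrix whose multiplication operator is the Okounkov operator on the side `σ`: the
transposition `(k, l)` acts as `∑ e_{ij} ⊗ e_{ji}` on the factors `k` and `l`, and averaging over
`l` replaces `e_{ji}` by its expectation in the reference vector. -/
def okMatrix (p : PMF Site) (σ : Bool) : M2 :=
  Matrix.of fun i j => hs (refMatrix p) (side σ (Matrix.single j i 1) (refMatrix p))

lemma map_eq_sum_single {R m n M : Type*} [CommSemiring R] [Fintype m] [Fintype n] [DecidableEq m]
    [DecidableEq n] [AddCommMonoid M] [Module R M] (f : Matrix m n R →ₗ[R] M) (x : Matrix m n R) :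
    f x = ∑ q : m × n, x q.1 q.2 • f (Matrix.single q.1 q.2 1) := by
  conv_lhs => rw [Matrix.matrix_eq_sum_single x]
  simp only [map_sum, ← map_smul, Matrix.smul_single, smul_eq_mul, mul_one, Fintype.sum_prod_type]

section Transpositions

variable {π : Wreath × Wreath →* unitary (L2X p →L[ℂ] L2X p)} {J : L2X p ≃ₗᵢ[ℂ] TensorH p}

lemma tendsto_average_transp_tensor (hp : ∀ z, p z ≠ 0) (hπ : IsRepMu p π) (hJ : IsTensorId p J)
    (σ : Bool) (k : ℕ) (a : ElemTensor p) :
    Tendsto (fun n : ℕ => (n : ℂ)⁻¹ • ∑ l ∈ Finset.range n,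
      J.conjStarAlgEquiv (π (sideEmb σ (permG (transp k l)))) (tensor a)) atTop
      (𝓝 (siteOp k (side σ (okMatrix p σ)) (tensor a))) := by
  let e (q : Fin 2 × Fin 2) : Module.End ℂ M2 := side σ (Matrix.single q.1 q.2 1)
  have hterm (q : Fin 2 × Fin 2) : Tendsto
      (fun n : ℕ => siteOp k (e q)
        ((n : ℂ)⁻¹ • ∑ l ∈ Finset.range n, siteOp l (e q.swap) (tensor a)))
      atTop (𝓝 (siteOp k (e q) (okMatrix p σ q.1 q.2 • tensor a))) :=
    ((siteOp k (e q)).continuous.tendsto _).comp (tendsto_average_siteOp (e q.swap) a)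
  have hlimit : siteOp k (side σ (okMatrix p σ)) (tensor a)
      = ∑ q, siteOp k (e q) (okMatrix p σ q.1 q.2 • tensor a) := by
    simpa using DFunLike.congr_fun (map_eq_sum_single
      ((siteOp (p := p) k).toLinearMap ∘ₗ (side σ).toLinearMap) (okMatrix p σ)) (tensor a)
  have hexchange : (fun l => J.conjStarAlgEquiv (π (sideEmb σ (permG (transp k l)))) (tensor a))
      =ᶠ[atTop] fun l => ∑ q, siteOp k (e q) (siteOp l (e q.swap) (tensor a)) := by
    filter_upwards [eventually_gt_atTop k] with l hl
    simp [hJ.conj_transp hp hπ σ hl.ne, e]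
  refine tendsto_average_of_eventuallyEq hexchange ?_
  rw [hlimit]
  refine (tendsto_finsetSum Finset.univ fun q _ => hterm q).congr fun n => ?_
  simp only [map_smul, map_sum, ← Finset.smul_sum]
  rw [Finset.sum_comm]

lemma tendsto_average_transp (hp : ∀ z, p z ≠ 0) (hπ : IsRepMu p π) (hJ : IsTensorId p J)
    (σ : Bool) (k : ℕ) (v : TensorH p) :
    Tendsto (fun n : ℕ => (n : ℂ)⁻¹ • ∑ l ∈ Finset.range n,
      J.conjStarAlgEquiv (π (sideEmb σ (permG (transp k l)))) v) atTop
      (𝓝 (siteOp k (side σ (okMatrix p σ)) v)) := by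
  let U (l : ℕ) : TensorH p →L[ℂ] TensorH p :=
    J.conjStarAlgEquiv (π (sideEmb σ (permG (transp k l))) : L2X p →L[ℂ] L2X p)
  have hU (l : ℕ) : ‖U l‖ ≤ 1 :=
    ContinuousLinearMap.opNorm_le_bound _ zero_le_one fun x => by
      rw [LinearIsometryEquiv.conjStarAlgEquiv_apply_apply, J.norm_map, Unitary.norm_map,
        J.symm.norm_map, one_mul]
  have haverage := tendsto_of_dense_span (l := atTop) (norm_average_le zero_le_one hU)
    (dense_span_tensor (p := p)) (T := siteOp k (side σ (okMatrix p σ)))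
    (Set.forall_mem_range.2 fun a => by
      simpa [U] using tendsto_average_transp_tensor hp hπ hJ σ k a) v
  simpa only [_root_.smul_apply, _root_.sum_apply] using haverage

end Transpositions

lemma okMatrix_offdiag (hp : ∀ z, p z ≠ 0) (σ : Bool) :
    okMatrix p σ 0 1 ≠ 0 ∧ okMatrix p σ 1 0 ≠ 0 := by
  have hpos (z : Site) : 0 < Real.sqrt (p z).toReal :=
    Real.sqrt_pos.2 (ENNReal.toReal_pos (hp z) (p.apply_ne_top z))
  have hsum (x y z w : Site) : ((Real.sqrt (p x).toReal : ℂ) * (Real.sqrt (p y).toReal : ℂ)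
      + (Real.sqrt (p z).toReal : ℂ) * (Real.sqrt (p w).toReal : ℂ)) ≠ 0 := by
    exact_mod_cast (add_pos (mul_pos (hpos x) (hpos y)) (mul_pos (hpos z) (hpos w))).ne'
  cases σ <;> constructor <;>
    simpa [okMatrix, hs_apply, Fintype.sum_prod_type, Matrix.mul_apply, Matrix.single_apply,
      refMatrix, siteMatrix] using hsum _ _ _ _

section Generation

variable {A : Subalgebra ℂ M2}

lemma single_self_mem_of_signMatrix_mem (hZ : signMatrix 1 ∈ A) (i : Fin 2) :
    (Matrix.single i i 1 : M2) ∈ A := by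
  have hhalf : (Matrix.single i i 1 : M2) = (2⁻¹ : ℂ) • (1 + (-1) ^ (i : ℕ) • signMatrix 1) := by
    ext j k
    fin_cases i <;> fin_cases j <;> fin_cases k <;>
      simp [signMatrix, ZMod.val_one, ← two_mul]
  exact hhalf ▸ A.smul_mem (A.add_mem A.one_mem (A.zsmul_mem hZ _)) _

lemma single_mem_of_ne_zero (hA : ∀ i, (Matrix.single i i 1 : M2) ∈ A) {Q : M2} (hQ : Q ∈ A)
    {i j : Fin 2} (hij : Q i j ≠ 0) : (Matrix.single i j 1 : M2) ∈ A := by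
  have hcut : (Matrix.single i j 1 : M2)
      = (Q i j)⁻¹ • (Matrix.single i i 1 * Q * Matrix.single j j 1) := by
    rw [Matrix.single_mul_mul_single]
    simp [hij]
  exact hcut ▸ A.smul_mem (A.mul_mem (A.mul_mem (hA i) hQ) (hA j)) _

lemma subalgebra_eq_top {Q : M2} (hZ : signMatrix 1 ∈ A) (hQ : Q ∈ A)
    (h01 : Q 0 1 ≠ 0) (h10 : Q 1 0 ≠ 0) : A = ⊤ := by
  have hdiag := single_self_mem_of_signMatrix_mem hZ
  have hsingle (q : Fin 2 × Fin 2) : (Matrix.single q.1 q.2 1 : M2) ∈ A := by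
    obtain ⟨i, j⟩ := q
    fin_cases i <;> fin_cases j
    exacts [hdiag 0, single_mem_of_ne_zero hdiag hQ h01, single_mem_of_ne_zero hdiag hQ h10,
      hdiag 1]
  refine eq_top_iff.2 fun x _ => ?_
  rw [← LinearMap.id_apply (R := ℂ) x, map_eq_sum_single]
  exact A.sum_mem fun q _ => A.smul_mem (hsingle q) _

end Generation

/-! ### The generated algebras -/

lemma image_centralizer {M N : Type*} [Mul M] [Mul N] (e : M ≃* N) (S : Set M) :
    e '' S.centralizer = (e '' S).centralizer := by
  ext b
  constructor
  · rintro ⟨a, ha, rfl⟩ _ ⟨s, hs, rfl⟩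
    rw [← map_mul, ← map_mul, ha s hs]
  · intro hb
    refine ⟨e.symm b, fun s hs => e.injective ?_, e.apply_symm_apply b⟩
    rw [map_mul, map_mul, e.apply_symm_apply]
    exact hb _ ⟨s, hs, rfl⟩

lemma sideAlg_eq_doubleCommutant (σ : Bool) :
    sideAlg p σ = doubleCommutant {T | ∃ b : LocalElem, IsSideMul σ b T} := by
  rw [sideAlg, wstarGenerated, Set.union_eq_left.2]
  rintro _ ⟨T, ⟨b, hb⟩, rfl⟩
  exact ⟨_, hb.star⟩

lemma FinPerm.eq_top_of_transp_mem {K : Subgroup FinPerm} (h : ∀ k l, transp k l ∈ K) :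
    K = ⊤ := by
  have hle : Subgroup.closure {τ : Equiv.Perm ℕ | τ.IsSwap} ≤ K.map FinPerm.subtype := by
    rw [Subgroup.closure_le]
    rintro _ ⟨k, l, -, rfl⟩
    exact ⟨transp k l, h k l, rfl⟩
  refine eq_top_iff.2 fun s _ => ?_
  obtain ⟨t, ht, hts⟩ := hle (mem_closure_isSwap'.2 s.2)
  exact (Subtype.ext hts : t = s) ▸ ht

/-- The subgroup of the group elements represented by operators that commute with `T`. -/
def commSubgroup {M G : Type*} [Monoid M] [Group G] (ρ : G →* M) (T : M) : Subgroup G where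
  carrier := {g | Commute (ρ g) T}
  one_mem' := by simp
  mul_mem' hg hh := by simpa using Commute.mul_left hg hh
  inv_mem' {g} hg := Commute.units_inv_left (u := ρ.toHomUnits g) hg

section Commutants

variable {π : Wreath × Wreath →* unitary (L2X p →L[ℂ] L2X p)} {J : L2X p ≃ₗᵢ[ℂ] TensorH p}
  {σ : Bool} {T : TensorH p →L[ℂ] TensorH p}

/-- The representation of `G` on the side `σ`, in the tensor picture. -/
def tensorRep (π : Wreath × Wreath →* unitary (L2X p →L[ℂ] L2X p))
    (J : L2X p ≃ₗᵢ[ℂ] TensorH p) (σ : Bool) : Wreath →* (TensorH p →L[ℂ] TensorH p) :=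
  (J.conjStarAlgEquiv : (L2X p →L[ℂ] L2X p) →* (TensorH p →L[ℂ] TensorH p)).comp
    ((unitary (L2X p →L[ℂ] L2X p)).subtype.comp (π.comp (sideEmb σ)))

lemma tensorRep_apply (g : Wreath) :
    tensorRep π J σ g = J.conjStarAlgEquiv (π (sideEmb σ g)) := rfl

lemma tensorRep_transp_commute (hp : ∀ z, p z ≠ 0) (hπ : IsRepMu p π) (hJ : IsTensorId p J)
    (hT : ∀ b S, IsSideMul σ b S → Commute S T) (k l : ℕ) :
    Commute (tensorRep π J σ (permG (transp k l))) T := by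
  rcases eq_or_ne k l with rfl | hkl
  · have hone : permG (transp k k) = 1 :=
      (congrArg permG (Subtype.ext (Equiv.swap_self k))).trans (map_one SemidirectProduct.inr)
    rw [hone, map_one]
    exact Commute.one_left T
  · rw [tensorRep_apply, hJ.conj_transp hp hπ σ hkl]
    exact Commute.sum_left _ _ _ fun q _ =>
      (hT _ _ (isSideMul_siteOp σ k _)).mul_left (hT _ _ (isSideMul_siteOp σ l _))

lemma tensorRep_commute (hp : ∀ z, p z ≠ 0) (hπ : IsRepMu p π) (hJ : IsTensorId p J)
    (hT : ∀ b S, IsSideMul σ b S → Commute S T) (g : Wreath) : Commute (tensorRep π J σ g) T := by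
  have hgamma (γ : ℕ →₀ ZMod 2) : gammaG γ ∈ commSubgroup (tensorRep π J σ) T :=
    hT _ _ (hJ.conj_gamma hp hπ σ γ)
  have hperm : (commSubgroup (tensorRep π J σ) T).comap SemidirectProduct.inr = ⊤ :=
    FinPerm.eq_top_of_transp_mem fun k l => tensorRep_transp_commute hp hπ hJ hT k l
  have hmem := (commSubgroup (tensorRep π J σ) T).mul_mem (hgamma g.left.toAdd)
    (Subgroup.mem_comap.1 (hperm ▸ Subgroup.mem_top g.right))
  rwa [gammaG, ofAdd_toAdd, SemidirectProduct.inl_left_mul_inr_right] at hmem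

lemma signElem_single (k : ℕ) (g : ZMod 2) :
    signElem (Finsupp.single k g) = LocalElem.single k (signMatrix g) := by
  ext1 i
  rcases eq_or_ne i k with rfl | h
  · simp [signElem]
  · simp [signElem, h, signMatrix]

lemma okMatrix_commute (hp : ∀ z, p z ≠ 0) (hπ : IsRepMu p π) (hJ : IsTensorId p J)
    (hT : ∀ g, Commute (tensorRep π J σ g) T) (k : ℕ) :
    Commute (siteOp k (side σ (okMatrix p σ))) T := by
  refine ContinuousLinearMap.ext fun v => ?_
  have hlim := (T.continuous.tendsto _).comp (tendsto_average_transp hp hπ hJ σ k v)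
  refine tendsto_nhds_unique (tendsto_average_transp hp hπ hJ σ k (T v)) (hlim.congr fun n => ?_)
  simp only [Function.comp_apply, map_smul, map_sum]
  congr 1
  exact Finset.sum_congr rfl fun l _ => (DFunLike.congr_fun (hT (permG (transp k l))).eq v).symm

lemma siteOp_commute (hp : ∀ z, p z ≠ 0) (hπ : IsRepMu p π) (hJ : IsTensorId p J)
    (hT : ∀ g, Commute (tensorRep π J σ g) T) (k : ℕ) (e : M2) :
    Commute (siteOp k (side σ e)) T := by
  let A : Subalgebra ℂ M2 := (Subalgebra.centralizer ℂ {T}).comap ((siteOp k).comp (side σ))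
  have hA (e : M2) : e ∈ A ↔ Commute (siteOp k (side σ e)) T := by
    simp [A, Subalgebra.mem_centralizer_iff, commute_iff_eq, eq_comm]
  have hZ : signMatrix 1 ∈ A := by
    have hsign := signElem_single k 1 ▸ hJ.conj_gamma hp hπ σ (Finsupp.single k 1)
    rw [hA, (isSideMul_siteOp σ k (signMatrix 1)).unique hsign]
    exact hT _
  have hQ : okMatrix p σ ∈ A := (hA _).2 (okMatrix_commute hp hπ hJ hT k)
  have htop := subalgebra_eq_top hZ hQ (okMatrix_offdiag hp σ).1 (okMatrix_offdiag hp σ).2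
  exact (hA e).1 (htop ▸ Algebra.mem_top)

lemma IsSideMul.commute_of_tensorRep (hp : ∀ z, p z ≠ 0) (hπ : IsRepMu p π) (hJ : IsTensorId p J)
    (hT : ∀ g, Commute (tensorRep π J σ g) T) {b : LocalElem} {S : TensorH p →L[ℂ] TensorH p}
    (hS : IsSideMul σ b S) : Commute S T := by
  obtain ⟨n, hn⟩ := eventually_atTop.1 b.eventually_one
  rw [hS.unique (LocalElem.truncate_toFun_eq hn ▸ isSideMul_prod_siteOp σ b.toFun n)]
  refine Commute.list_prod_left _ _ fun U hU => ?_
  obtain ⟨i, -, rfl⟩ := List.mem_map.1 hU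
  exact siteOp_commute hp hπ hJ hT i _

lemma doubleCommutant_rep (hp : ∀ z, p z ≠ 0) (hπ : IsRepMu p π) (hJ : IsTensorId p J)
    (σ : Bool) :
    doubleCommutant (Set.range fun g => (π (sideEmb σ g) : L2X p →L[ℂ] L2X p))
      = pullOp J '' sideAlg p σ := by
  have hcentralizer : Set.centralizer {T : TensorH p →L[ℂ] TensorH p | ∃ b, IsSideMul σ b T}
      = Set.centralizer (Set.range (tensorRep π J σ)) := by
    ext T
    constructor
    · rintro hT _ ⟨g, rfl⟩
      exact tensorRep_commute hp hπ hJ (fun b S hS => hT S ⟨b, hS⟩) g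
    · rintro hT S ⟨b, hS⟩
      exact hS.commute_of_tensorRep hp hπ hJ fun g => hT _ ⟨g, rfl⟩
  let e : (TensorH p →L[ℂ] TensorH p) ≃* (L2X p →L[ℂ] L2X p) := J.conjStarAlgEquiv.symm
  change _ = e '' sideAlg p σ
  rw [sideAlg_eq_doubleCommutant, doubleCommutant, doubleCommutant, hcentralizer,
    image_centralizer, image_centralizer, ← Set.range_comp]
  congr 3
  funext g
  exact (J.conjStarAlgEquiv.symm_apply_apply _).symm

end Commutants

/-! ### Modular operators of approximately finite-dimensional pairs -/

section Modular

variable {H : Type*} [NormedAddCommGroup H] [InnerProductSpace ℂ H] [CompleteSpace H]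

/-- A commuting pair of `*`-closed sets of operators together with an increasing sequence of
finite-dimensional subspaces with dense union, every vector of which both sets reach from `ξ` by
an operator whose adjoint maps `ξ` into the same subspace. -/
structure TomitaPair (M N : Set (H →L[ℂ] H)) (ξ : H) (K : ℕ → Submodule ℂ H) : Prop where
  star_left : ∀ a ∈ M, star a ∈ M
  star_right : ∀ b ∈ N, star b ∈ N
  comm : ∀ a ∈ M, ∀ b ∈ N, a * b = b * a
  mono : Monotone K
  finite : ∀ n, FiniteDimensional ℂ (K n)
  dense : Dense ((⨆ n, K n : Submodule ℂ H) : Set H)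
  lift_left : ∀ n, ∀ x ∈ K n, ∃ a ∈ M, a ξ = x ∧ (star a) ξ ∈ K n
  lift_right : ∀ n, ∀ x ∈ K n, ∃ b ∈ N, b ξ = x ∧ (star b) ξ ∈ K n

namespace TomitaPair

variable {M N : Set (H →L[ℂ] H)} {ξ : H} {K : ℕ → Submodule ℂ H}

lemma symm (h : TomitaPair M N ξ K) : TomitaPair N M ξ K where
  star_left := h.star_right
  star_right := h.star_left
  comm b hb a ha := (h.comm a ha b hb).symm
  mono := h.mono
  finite := h.finite
  dense := h.dense
  lift_left := h.lift_right
  lift_right := h.lift_left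

lemma cyclic (h : TomitaPair M N ξ K) : Dense {v : H | ∃ a ∈ M, v = a ξ} := by
  refine h.dense.mono fun x hx => ?_
  obtain ⟨n, hn⟩ := (Submodule.mem_iSup_of_directed _ h.mono.directed_le).1 hx
  obtain ⟨a, ha, hax, -⟩ := h.lift_left n x hn
  exact ⟨a, ha, hax.symm⟩

lemma separating (h : TomitaPair M N ξ K) (a : H →L[ℂ] H) (ha : a ∈ M) (haξ : a ξ = 0) :
    a = 0 := by
  refine DFunLike.coe_injective
    (Continuous.ext_on h.symm.cyclic a.continuous (0 : H →L[ℂ] H).continuous ?_)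
  rintro _ ⟨b, hb, rfl⟩
  rw [← mul_apply_eq_comp, h.comm a ha b hb, mul_apply_eq_comp, haξ, map_zero]
  rfl

lemma inner_star (h : TomitaPair M N ξ K) {a b : H →L[ℂ] H} (ha : a ∈ M) (hb : b ∈ N) :
    inner ℂ ((star b) ξ) (a ξ) = inner ℂ ((star a) ξ) (b ξ) := by
  rw [ContinuousLinearMap.star_eq_adjoint, ContinuousLinearMap.star_eq_adjoint,
    ContinuousLinearMap.adjoint_inner_left, ContinuousLinearMap.adjoint_inner_left,
    ← mul_apply_eq_comp, ← mul_apply_eq_comp, h.comm a ha b hb]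

lemma exists_compression (h : TomitaPair M N ξ K) {u v : H}
    (huv : ∀ b ∈ N, inner ℂ ((star b) ξ) u = inner ℂ v (b ξ)) (n : ℕ) :
    haveI := h.finite n
    ∃ a ∈ M, a ξ = (K n).starProjection u ∧ (star a) ξ = (K n).starProjection v := by
  have := h.finite n
  have hproj (x : H) (hx : x ∈ K n) (w : H) :
      inner ℂ x ((K n).starProjection w) = inner ℂ x w := by
    rw [← Submodule.inner_starProjection_left_eq_right, Submodule.starProjection_eq_self_iff.2 hx]
  obtain ⟨a, ha, hau, hstar⟩ := h.lift_left n _ ((K n).starProjection_apply_mem u)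
  refine ⟨a, ha, hau, ?_⟩
  -- The difference of the two sides lies in `K n`, so it has the form `b ξ`, and it is
  -- orthogonal to itself.
  have hdiff := (K n).sub_mem hstar ((K n).starProjection_apply_mem v)
  obtain ⟨b, hb, hbdiff, hbK⟩ := h.lift_right n _ hdiff
  have hleft : inner ℂ ((star a) ξ) (b ξ) = inner ℂ v (b ξ) := by
    rw [← h.inner_star ha hb, hau, hproj _ hbK, huv b hb]
  have hright : inner ℂ ((K n).starProjection v) (b ξ) = inner ℂ v (b ξ) := by
    rw [← inner_conj_symm, hproj _ (hbdiff ▸ hdiff), inner_conj_symm]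
  rw [← sub_eq_zero, ← inner_self_eq_zero (𝕜 := ℂ)]
  conv_lhs => rw [inner_sub_left, ← hbdiff]
  rw [hleft, hright, sub_self]

lemma mem_closure_of_starProjection_mem (h : TomitaPair M N ξ K) {R : Set (H × H)} {u w : H}
    (hR : ∀ n, haveI := h.finite n
      ((K n).starProjection u, (K n).starProjection w) ∈ R) : (u, w) ∈ closure R := by
  have := h.finite
  have htop : ⊤ ≤ (⨆ n, K n).topologicalClosure :=
    (Submodule.dense_iff_topologicalClosure_eq_top.1 h.dense).ge
  have hu := Submodule.starProjection_tendsto_self K h.mono u htop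
  have hw := Submodule.starProjection_tendsto_self K h.mono w htop
  exact mem_closure_of_tendsto (hu.prodMk_nhds hw) (Eventually.of_forall hR)

lemma mem_tomitaGraph_iff (h : TomitaPair M N ξ K) (u v : H) :
    (u, v) ∈ tomitaGraph M ξ ↔ ∀ b ∈ N, inner ℂ ((star b) ξ) u = inner ℂ v (b ξ) := by
  constructor
  · intro huv b hb
    have hclosed : IsClosed {z : H × H | inner ℂ ((star b) ξ) z.1 = inner ℂ z.2 (b ξ)} :=
      isClosed_eq (by fun_prop) (by fun_prop)
    refine closure_minimal ?_ hclosed huv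
    rintro _ ⟨a, ha, rfl⟩
    exact h.inner_star ha hb
  · intro huv
    refine h.mem_closure_of_starProjection_mem fun n => ?_
    obtain ⟨a, ha, hau, hav⟩ := h.exists_compression huv n
    exact ⟨a, ha, Prod.ext hau.symm hav.symm⟩

lemma starProjection_mem_tomitaGraph (h : TomitaPair M N ξ K) {u v : H}
    (huv : (u, v) ∈ tomitaGraph M ξ) (n : ℕ) :
    haveI := h.finite n
    ((K n).starProjection u, (K n).starProjection v) ∈ tomitaGraph M ξ := by
  obtain ⟨a, ha, hau, hav⟩ := h.exists_compression ((h.mem_tomitaGraph_iff u v).1 huv) n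
  exact subset_closure ⟨a, ha, Prod.ext hau.symm hav.symm⟩

lemma closable (h : TomitaPair M N ξ K) (u v w : H) (hv : (u, v) ∈ tomitaGraph M ξ)
    (hw : (u, w) ∈ tomitaGraph M ξ) : v = w := by
  refine h.symm.cyclic.eq_of_inner_left (𝕜 := ℂ) ?_
  rintro _ ⟨b, hb, rfl⟩
  rw [← (h.mem_tomitaGraph_iff u v).1 hv b hb, ← (h.mem_tomitaGraph_iff u w).1 hw b hb]

lemma adjoint (h : TomitaPair M N ξ K) (u v : H) : (u, v) ∈ tomitaGraph N ξ ↔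
    ∀ x y, (x, y) ∈ tomitaGraph M ξ → inner ℂ y u = inner ℂ v x := by
  rw [h.symm.mem_tomitaGraph_iff]
  constructor
  · intro huv x y hxy
    have hclosed : IsClosed {z : H × H | inner ℂ z.2 u = inner ℂ v z.1} :=
      isClosed_eq (by fun_prop) (by fun_prop)
    refine closure_minimal ?_ hclosed hxy
    rintro _ ⟨a, ha, rfl⟩
    exact huv a ha
  · intro huv a ha
    exact huv _ _ (subset_closure ⟨a, ha, rfl⟩)

lemma zero_mem_tomitaGraph (h : TomitaPair M N ξ K) : ((0 : H), (0 : H)) ∈ tomitaGraph M ξ := by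
  simp [h.mem_tomitaGraph_iff]

lemma add_mem_tomitaGraph (h : TomitaPair M N ξ K) {u v u' v' : H}
    (huv : (u, v) ∈ tomitaGraph M ξ) (huv' : (u', v') ∈ tomitaGraph M ξ) :
    (u + u', v + v') ∈ tomitaGraph M ξ := by
  rw [h.mem_tomitaGraph_iff] at huv huv' ⊢
  intro b hb
  rw [inner_add_right, inner_add_left, huv b hb, huv' b hb]

lemma smul_mem_tomitaGraph (h : TomitaPair M N ξ K) {u v : H} (c : ℂ)
    (huv : (u, v) ∈ tomitaGraph M ξ) : (c • u, star c • v) ∈ tomitaGraph M ξ := by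
  rw [h.mem_tomitaGraph_iff] at huv ⊢
  intro b hb
  rw [inner_smul_right, inner_smul_left, huv b hb, ← starRingEnd_apply, Complex.conj_conj]

/-- The graph of `F S`, where `S` and `F` are the closures of `a ξ ↦ a* ξ` on `M` and on `N`. -/
def modularGraph (h : TomitaPair M N ξ K) : Submodule ℂ (H × H) where
  carrier := {z | ∃ v, (z.1, v) ∈ tomitaGraph M ξ ∧ (v, z.2) ∈ tomitaGraph N ξ}
  zero_mem' := ⟨0, h.zero_mem_tomitaGraph, h.symm.zero_mem_tomitaGraph⟩
  add_mem' := fun ⟨v, hS, hF⟩ ⟨v', hS', hF'⟩ =>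
    ⟨v + v', h.add_mem_tomitaGraph hS hS', h.symm.add_mem_tomitaGraph hF hF'⟩
  smul_mem' c z := fun ⟨v, hS, hF⟩ => ⟨star c • v, h.smul_mem_tomitaGraph c hS,
    by simpa only [star_star, Prod.smul_snd] using h.symm.smul_mem_tomitaGraph (star c) hF⟩

lemma mem_modularGraph (h : TomitaPair M N ξ K) {u w : H} : (u, w) ∈ h.modularGraph ↔
    ∃ v, (u, v) ∈ tomitaGraph M ξ ∧ (v, w) ∈ tomitaGraph N ξ := Iff.rfl

lemma norm_sq_le (h : TomitaPair M N ξ K) {u v w : H} (hS : (u, v) ∈ tomitaGraph M ξ)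
    (hF : (v, w) ∈ tomitaGraph N ξ) : ‖v‖ ^ 2 ≤ ‖w‖ * ‖u‖ :=
  calc ‖v‖ ^ 2 = ‖inner ℂ v v‖ := by rw [inner_self_eq_norm_sq_to_K]; simp
    _ = ‖inner ℂ w u‖ := by rw [(h.adjoint v w).1 hF u v hS]
    _ ≤ ‖w‖ * ‖u‖ := norm_inner_le_norm _ _

lemma dist_le_of_mem_tomitaGraph (h : TomitaPair M N ξ K) {z z' : H × H} {v v' : H}
    (hS : (z.1, v) ∈ tomitaGraph M ξ) (hF : (v, z.2) ∈ tomitaGraph N ξ)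
    (hS' : (z'.1, v') ∈ tomitaGraph M ξ) (hF' : (v', z'.2) ∈ tomitaGraph N ξ) :
    dist v v' ≤ dist z z' := by
  have hS₀ : (z.1 - z'.1, v - v') ∈ tomitaGraph M ξ := by
    simpa [sub_eq_add_neg] using h.add_mem_tomitaGraph hS (h.smul_mem_tomitaGraph (-1) hS')
  have hF₀ : (v - v', z.2 - z'.2) ∈ tomitaGraph N ξ := by
    simpa [sub_eq_add_neg] using
      h.symm.add_mem_tomitaGraph hF (h.symm.smul_mem_tomitaGraph (-1) hF')
  refine le_of_sq_le_sq ?_ dist_nonneg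
  calc dist v v' ^ 2 ≤ dist z.2 z'.2 * dist z.1 z'.1 := by
        simpa only [dist_eq_norm] using h.norm_sq_le hS₀ hF₀
    _ ≤ dist z z' * dist z z' := mul_le_mul (le_max_right _ _) (le_max_left _ _) dist_nonneg
        dist_nonneg
    _ = dist z z' ^ 2 := (sq _).symm

lemma isClosed_modularGraph (h : TomitaPair M N ξ K) :
    IsClosed (h.modularGraph : Set (H × H)) := by
  refine IsSeqClosed.isClosed fun z z₀ hz hlim => ?_
  choose v hS hF using hz
  have hcauchy : CauchySeq v := by
    refine Metric.cauchySeq_iff.2 fun ε hε => ?_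
    obtain ⟨n₀, hn₀⟩ := Metric.cauchySeq_iff.1 hlim.cauchySeq ε hε
    exact ⟨n₀, fun m hm n hn =>
      (h.dist_le_of_mem_tomitaGraph (hS m) (hF m) (hS n) (hF n)).trans_lt (hn₀ m hm n hn)⟩
  obtain ⟨v₀, hv₀⟩ := cauchySeq_tendsto_of_complete hcauchy
  exact ⟨v₀,
    isClosed_closure.mem_of_tendsto (((continuous_fst.tendsto z₀).comp hlim).prodMk_nhds hv₀)
      (Eventually.of_forall hS),
    isClosed_closure.mem_of_tendsto (hv₀.prodMk_nhds ((continuous_snd.tendsto z₀).comp hlim))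
      (Eventually.of_forall hF)⟩

lemma snd_eq_zero_of_mem_modularGraph (h : TomitaPair M N ξ K) (z : H × H)
    (hz : z ∈ h.modularGraph) (hfst : z.1 = 0) : z.2 = 0 := by
  obtain ⟨v, hS, hF⟩ := hz
  have hv : v = 0 := h.closable _ _ _ (hfst ▸ hS) h.zero_mem_tomitaGraph
  exact h.symm.closable _ _ _ (hv ▸ hF) h.symm.zero_mem_tomitaGraph

/-- The modular operator `F S` of the pair. -/
def modularOp (h : TomitaPair M N ξ K) : H →ₗ.[ℂ] H := h.modularGraph.toLinearPMap

lemma graph_modularOp (h : TomitaPair M N ξ K) : h.modularOp.graph = h.modularGraph :=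
  Submodule.toLinearPMap_graph_eq _ h.snd_eq_zero_of_mem_modularGraph

lemma isModularOperator (h : TomitaPair M N ξ K) : IsModularOperator M N ξ h.modularOp where
  cyclic := h.cyclic
  separating := h.separating
  closable_S := h.closable
  closable_F := h.symm.closable
  adjoint := h.adjoint
  graph u w := by rw [graph_modularOp, h.mem_modularGraph]

lemma isClosed_modularOp (h : TomitaPair M N ξ K) : h.modularOp.IsClosed := by
  rw [LinearPMap.IsClosed, graph_modularOp]
  exact h.isClosed_modularGraph

lemma iSup_le_domain_modularOp (h : TomitaPair M N ξ K) : ⨆ n, K n ≤ h.modularOp.domain := by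
  refine iSup_le fun n x hx => ?_
  obtain ⟨a, ha, rfl, haK⟩ := h.lift_left n x hx
  obtain ⟨b, hb, hba, -⟩ := h.lift_right n _ haK
  refine LinearPMap.mem_domain_of_mem_graph (y := (star b) ξ) ?_
  rw [graph_modularOp]
  exact ⟨(star a) ξ, subset_closure ⟨a, ha, rfl⟩, subset_closure ⟨b, hb, by rw [hba]⟩⟩

lemma starProjection_mem_graph_domRestrict (h : TomitaPair M N ξ K) {u w : H}
    (huw : (u, w) ∈ h.modularOp.graph) (n : ℕ) :
    haveI := h.finite n
    ((K n).starProjection u, (K n).starProjection w)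
      ∈ (h.modularOp.domRestrict (⨆ n, K n)).graph := by
  have := h.finite n
  rw [graph_modularOp] at huw
  obtain ⟨v, hS, hF⟩ := huw
  have hgraph : ((K n).starProjection u, (K n).starProjection w) ∈ h.modularOp.graph := by
    rw [graph_modularOp]
    exact ⟨_, h.starProjection_mem_tomitaGraph hS n, h.symm.starProjection_mem_tomitaGraph hF n⟩
  have hmem : (K n).starProjection u ∈ ⨆ n, K n :=
    Submodule.mem_iSup_of_mem n ((K n).starProjection_apply_mem u)
  obtain ⟨y, hy, hyw⟩ := (LinearPMap.mem_graph_iff _).1 hgraph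
  exact (LinearPMap.mem_graph_iff _).2
    ⟨⟨_, hmem, h.iSup_le_domain_modularOp hmem⟩, rfl,
      (LinearPMap.domRestrict_apply hy.symm).trans hyw⟩

lemma hasCore (h : TomitaPair M N ξ K) : h.modularOp.HasCore (⨆ n, K n) := by
  have hle : h.modularOp.domRestrict (⨆ n, K n) ≤ h.modularOp := LinearPMap.domRestrict_le
  refine ⟨h.iSup_le_domain_modularOp, LinearPMap.eq_of_eq_graph ?_⟩
  rw [← (h.isClosed_modularOp.isClosable.leIsClosable hle).graph_closure_eq_closure_graph]
  exact le_antisymm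
    (Submodule.topologicalClosure_minimal _ (LinearPMap.le_graph_of_le hle) h.isClosed_modularOp)
    fun _ hz => h.mem_closure_of_starProjection_mem (h.starProjection_mem_graph_domRestrict hz)

end TomitaPair

end Modular

/-! ### The modular operator of the pair of multiplication algebras -/

/-- The `W^*`-algebra `sideAlg p σ` as a star subalgebra. -/
def sideStarAlg (p : PMF Site) (σ : Bool) : StarSubalgebra ℂ (TensorH p →L[ℂ] TensorH p) where
  toSubalgebra := Subalgebra.centralizer ℂ
    (Set.centralizer {T : TensorH p →L[ℂ] TensorH p | ∃ b, IsSideMul σ b T})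
  star_mem' := Set.star_mem_centralizer' fun _ hS =>
    Set.star_mem_centralizer' (fun _ ⟨_, hb⟩ => ⟨_, hb.star⟩) hS

lemma coe_sideStarAlg (σ : Bool) : (sideStarAlg p σ : Set _) = sideAlg p σ :=
  (sideAlg_eq_doubleCommutant σ).symm

lemma mem_sideStarAlg {σ : Bool} {T : TensorH p →L[ℂ] TensorH p} :
    T ∈ sideStarAlg p σ ↔ T ∈ sideAlg p σ := by
  rw [← coe_sideStarAlg, SetLike.mem_coe]

lemma IsSideMul.mem_sideStarAlg {σ : Bool} {b : LocalElem} {T : TensorH p →L[ℂ] TensorH p}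
    (hT : IsSideMul σ b T) : T ∈ sideStarAlg p σ :=
  Set.subset_centralizer_centralizer ⟨b, hT⟩

lemma sideStarAlg_comm {S T : TensorH p →L[ℂ] TensorH p} (hS : S ∈ sideStarAlg p false)
    (hT : T ∈ sideStarAlg p true) : S * T = T * S := by
  refine hT S fun R ⟨_, hR⟩ => hS R fun L ⟨_, hL⟩ => ?_
  exact hL.commute hR

/-- The span of the elementary tensors `a₀ ⊗ ⋯ ⊗ a_{n-1} ⊗ m ⊗ m ⊗ ⋯`. -/
def truncated (p : PMF Site) (n : ℕ) : Submodule ℂ (TensorH p) :=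
  Submodule.span ℂ {v | ∃ a : ElemTensor p, (∀ i, n ≤ i → a.toFun i = refMatrix p) ∧ v = tensor a}

lemma tensor_mem_truncated {n : ℕ} {a : ElemTensor p} (ha : ∀ i, n ≤ i → a.toFun i = refMatrix p) :
    tensor a ∈ truncated p n :=
  Submodule.subset_span ⟨a, ha, rfl⟩

lemma truncated_mono : Monotone (truncated p) := fun _ _ hmn =>
  Submodule.span_mono fun _ ⟨a, ha, hv⟩ => ⟨a, fun i hi => ha i (hmn.trans hi), hv⟩

lemma span_tensor_le_iSup_truncated :
    Submodule.span ℂ (Set.range (tensor (p := p))) ≤ ⨆ n, truncated p n := by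
  rw [Submodule.span_le]
  rintro _ ⟨a, rfl⟩
  obtain ⟨n, hn⟩ := eventually_atTop.1 a.eventually_ref
  exact Submodule.mem_iSup_of_mem n (tensor_mem_truncated hn)

lemma truncated_zero_le : truncated p 0 ≤ Submodule.span ℂ {refVector p} := by
  refine Submodule.span_mono ?_
  rintro _ ⟨a, ha, rfl⟩
  exact congrArg tensor (ElemTensor.ext fun i => ha i (Nat.zero_le i))

lemma truncated_succ_le {t : Site → Module.End ℂ M2}
    (ht : ∀ z, t z (refMatrix p) = Matrix.single z.1 z.2 1) (n : ℕ) :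
    truncated p (n + 1) ≤ ⨆ z, (truncated p n).map (siteOp n (t z)).toLinearMap := by
  refine Submodule.span_le.2 ?_
  rintro _ ⟨a, ha, rfl⟩
  have hmem : tensor (a.update n (refMatrix p)) ∈ truncated p n :=
    tensor_mem_truncated fun i hi => by
      rcases hi.eq_or_lt with rfl | hi
      · exact ElemTensor.update_self _ _ _
      · rw [ElemTensor.update_of_ne _ hi.ne', ha i hi]
  have hsum : tensor a = ∑ z, a.toFun n z.1 z.2 •
      siteOp n (t z) (tensor (a.update n (refMatrix p))) := by
    have hslot := map_eq_sum_single (slot a n) (a.toFun n)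
    rw [slot_apply, ElemTensor.update_eq_self] at hslot
    simp only [siteOp_tensor, ElemTensor.update_self, ElemTensor.update_update, ht]
    exact hslot
  rw [hsum]
  exact Submodule.sum_mem _ fun z _ => Submodule.smul_mem _ _
    (Submodule.mem_iSup_of_mem z ⟨_, hmem, rfl⟩)

lemma exists_end_apply_refMatrix (p : PMF Site) (x : M2) :
    ∃ t : Module.End ℂ M2, t (refMatrix p) = x :=
  ⟨(Matrix.traceLinearMap _ ℂ ℂ ∘ₗ LinearMap.mulLeft ℂ (refMatrix p)ᴴ).smulRight x, by
    simp [trace_refMatrix]⟩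

lemma finiteDimensional_truncated (n : ℕ) : FiniteDimensional ℂ (truncated p n) := by
  induction n with
  | zero => exact Submodule.finiteDimensional_of_le truncated_zero_le
  | succ n ih =>
    choose t ht using fun z : Site => exists_end_apply_refMatrix p (Matrix.single z.1 z.2 1)
    exact Submodule.finiteDimensional_of_le (truncated_succ_le ht n)

lemma isUnit_refMatrix (h : (Matrix.of fun k l : Fin 2 => (p (k, l)).toReal).det ≠ 0) :
    IsUnit (refMatrix p) := by
  rw [Matrix.isUnit_iff_isUnit_det, isUnit_iff_ne_zero]
  intro hdet
  refine h ?_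
  rw [Matrix.det_fin_two] at hdet ⊢
  simp only [refMatrix, siteMatrix, Matrix.of_apply, Pi.one_apply, one_mul] at hdet ⊢
  have hsqrt : Real.sqrt (p (0, 0)).toReal * Real.sqrt (p (1, 1)).toReal
      = Real.sqrt (p (0, 1)).toReal * Real.sqrt (p (1, 0)).toReal := by
    exact_mod_cast sub_eq_zero.1 hdet
  have hsq := congrArg (· ^ 2) hsqrt
  simp only [mul_pow, Real.sq_sqrt ENNReal.toReal_nonneg] at hsq
  rw [hsq, sub_self]

lemma IsSideMul.apply_refVector {σ : Bool} {b : LocalElem} {T : TensorH p →L[ℂ] TensorH p}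
    (hT : IsSideMul σ b T) {a : ElemTensor p}
    (h : ∀ i, side σ (b.toFun i) (refMatrix p) = a.toFun i) : T (refVector p) = tensor a :=
  (hT _).trans (congrArg tensor (ElemTensor.ext h))

lemma okMatrix_false : okMatrix p false = refMatrix p * (refMatrix p)ᴴ := by
  ext i j
  rw [okMatrix, Matrix.of_apply, side_false, hs, Matrix.trace_mul_comm, Matrix.mul_assoc,
    Matrix.trace_single_mul, one_smul]

section Invertible

variable (hm : IsUnit (refMatrix p))
include hm

lemma exists_side_refMatrix (σ : Bool) (x : M2) :
    ∃ e : M2, side σ e (refMatrix p) = x ∧ (x = refMatrix p → e = 1) := by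
  have hd := (Matrix.isUnit_iff_isUnit_det _).1 hm
  cases σ
  · refine ⟨x * (refMatrix p)⁻¹, ?_, fun h => ?_⟩
    · rw [side_false, Matrix.mul_assoc, Matrix.nonsing_inv_mul _ hd, Matrix.mul_one]
    · rw [h, Matrix.mul_nonsing_inv _ hd]
  · refine ⟨((refMatrix p)⁻¹ * x)ᵀ, ?_, fun h => ?_⟩
    · rw [side_true, Matrix.transpose_transpose, ← Matrix.mul_assoc, Matrix.mul_nonsing_inv _ hd,
        Matrix.one_mul]
    · rw [h, Matrix.nonsing_inv_mul _ hd, Matrix.transpose_one]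

lemma exists_isSideMul_refVector (σ : Bool) {n : ℕ} {a : ElemTensor p}
    (ha : ∀ i, n ≤ i → a.toFun i = refMatrix p) : ∃ b T, IsSideMul σ b T ∧
      T (refVector p) = tensor a ∧ (star T) (refVector p) ∈ truncated p n := by
  choose e he hone using fun i => exists_side_refMatrix hm σ (a.toFun i)
  let b : LocalElem := ⟨e, eventually_atTop.2 ⟨n, fun i hi => hone i (ha i hi)⟩⟩
  obtain ⟨T, hT⟩ := exists_isSideMul (p := p) σ b
  refine ⟨b, T, hT, hT.apply_refVector he, ?_⟩
  rw [refVector, hT.star]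
  refine tensor_mem_truncated fun i hi => ?_
  have hb : b.toFun i = 1 := hone i (ha i hi)
  rw [LocalElem.sideMul_toFun, LocalElem.star_toFun, hb, Matrix.conjTranspose_one,
    map_one, Module.End.one_apply]

lemma exists_sideStarAlg_refVector (σ : Bool) {n : ℕ} {x : TensorH p} (hx : x ∈ truncated p n) :
    ∃ T ∈ sideStarAlg p σ, T (refVector p) = x ∧ (star T) (refVector p) ∈ truncated p n := by
  induction hx using Submodule.span_induction with
  | mem x hx =>
    obtain ⟨a, ha, rfl⟩ := hx
    obtain ⟨b, T, hT, h⟩ := exists_isSideMul_refVector hm σ ha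
    exact ⟨T, hT.mem_sideStarAlg, h⟩
  | zero => exact ⟨0, zero_mem _, rfl, by simp⟩
  | add x y _ _ hx hy =>
    obtain ⟨S, hS, rfl, hS'⟩ := hx
    obtain ⟨T, hT, rfl, hT'⟩ := hy
    exact ⟨S + T, add_mem hS hT, rfl, by rw [star_add]; exact add_mem hS' hT'⟩
  | smul c x _ hx =>
    obtain ⟨S, hS, rfl, hS'⟩ := hx
    exact ⟨c • S, (sideStarAlg p σ).smul_mem hS c, rfl, by
      rw [star_smul]; exact Submodule.smul_mem _ _ hS'⟩

lemma tomitaPair : TomitaPair (leftAlg p) (rightAlg p) (refVector p) (truncated p) := by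
  rw [leftAlg_eq, rightAlg_eq, ← coe_sideStarAlg, ← coe_sideStarAlg]
  exact {
    star_left := fun _ => star_mem
    star_right := fun _ => star_mem
    comm := fun _ hS _ hT => sideStarAlg_comm hS hT
    mono := truncated_mono
    finite := finiteDimensional_truncated
    dense := dense_span_tensor.mono span_tensor_le_iSup_truncated
    lift_left := fun _ _ => exists_sideStarAlg_refVector hm false
    lift_right := fun _ _ => exists_sideStarAlg_refVector hm true }

lemma localVectors_eq : localVectors p = ⨆ n, truncated p n := by
  refine le_antisymm (Submodule.span_le.2 ?_) (iSup_le fun n => Submodule.span_le.2 ?_)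
  · rintro _ ⟨a, A, hA, rfl⟩
    exact span_tensor_le_iSup_truncated (Submodule.subset_span ⟨_, (hA _).symm⟩)
  · rintro _ ⟨a, ha, rfl⟩
    obtain ⟨b, T, hT, h, -⟩ := exists_isSideMul_refVector hm false ha
    exact Submodule.subset_span ⟨b, T, hT, h.symm⟩

lemma isUnit_okMatrix : IsUnit (okMatrix p false) := by
  rw [okMatrix_false]
  exact hm.mul (Matrix.star_eq_conjTranspose (refMatrix p) ▸ hm.star)

/-- The matrix identity behind `Δ(aξ) = P a P⁻¹ ξ`. -/
lemma refMatrix_mul_conjTranspose_conj (a : M2) :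
    refMatrix p * ((refMatrix p)⁻¹ * aᴴ * refMatrix p)ᴴ
      = okMatrix p false * a * (okMatrix p false)⁻¹ * refMatrix p := by
  have hd := (Matrix.isUnit_iff_isUnit_det _).1 hm
  simp only [okMatrix_false, Matrix.mul_inv_rev, Matrix.conjTranspose_mul,
    Matrix.conjTranspose_conjTranspose, Matrix.conjTranspose_nonsing_inv, Matrix.mul_assoc,
    Matrix.nonsing_inv_mul _ hd, Matrix.mul_one]

end Invertible

namespace LocalElem

variable (hm : IsUnit (refMatrix p))

/-- The element whose right action on `ξ` agrees with the left action of `b*`: at each site,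
`bᵢᴴ m = m (m⁻¹ bᵢᴴ m)`. The outer transpose is the one in `side true`. -/
def rightStar (b : LocalElem) : LocalElem :=
  ⟨fun i => ((refMatrix p)⁻¹ * (b.toFun i)ᴴ * refMatrix p)ᵀ, b.eventually_one.mono fun i hi => by
    rw [hi, Matrix.conjTranspose_one, Matrix.mul_one,
      Matrix.nonsing_inv_mul _ ((Matrix.isUnit_iff_isUnit_det _).1 hm), Matrix.transpose_one]⟩

lemma rightStar_toFun (b : LocalElem) (i : ℕ) :
    (b.rightStar hm).toFun i = ((refMatrix p)⁻¹ * (b.toFun i)ᴴ * refMatrix p)ᵀ := rfl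

lemma truncate_const_mul_truncate_const {e f : M2} (h : e * f = 1) (n : ℕ) :
    truncate n (fun _ => e) * truncate n (fun _ => f) = 1 := by
  ext1 i
  by_cases hi : i < n <;> simp [truncate_toFun, hi, h]

end LocalElem

section Conjugation

variable {σ : Bool} {b : LocalElem} {A B P : TensorH p →L[ℂ] TensorH p} {n : ℕ}

lemma IsSideMul.ringInverse {e : M2} (he : IsUnit e)
    (hP : IsSideMul σ (LocalElem.truncate n fun _ => e) P) :
    IsSideMul σ (LocalElem.truncate n fun _ => e⁻¹) (Ring.inverse P) := by
  have hd := (Matrix.isUnit_iff_isUnit_det _).1 he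
  obtain ⟨T, hT⟩ := exists_isSideMul (p := p) σ (LocalElem.truncate n fun _ => e⁻¹)
  have hPT : P * T = 1 := (LocalElem.truncate_const_mul_truncate_const
    (Matrix.mul_nonsing_inv _ hd) n ▸ hP.mul hT).unique (isSideMul_one σ)
  have hTP : T * P = 1 := (LocalElem.truncate_const_mul_truncate_const
    (Matrix.nonsing_inv_mul _ hd) n ▸ hT.mul hP).unique (isSideMul_one σ)
  rwa [show Ring.inverse P = T from Ring.inverse_unit ⟨P, T, hPT, hTP⟩]

lemma star_apply_refVector (hm : IsUnit (refMatrix p)) (hA : IsSideMul false b A)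
    (hB : IsSideMul true (b.rightStar hm) B) : (star A) (refVector p) = B (refVector p) := by
  refine (hA.star _).trans (hB.apply_refVector fun i => ?_).symm
  change _ = (b.toFun i)ᴴ * refMatrix p
  have hd := (Matrix.isUnit_iff_isUnit_det _).1 hm
  rw [side_true, LocalElem.rightStar_toFun, Matrix.transpose_transpose, Matrix.mul_assoc,
    ← Matrix.mul_assoc, Matrix.mul_nonsing_inv _ hd, Matrix.one_mul]

lemma side_star_rightStar_refMatrix (hm : IsUnit (refMatrix p)) (hb : ∀ i, n ≤ i → b.toFun i = 1)
    (i : ℕ) : side true ((star (b.rightStar hm)).toFun i) (refMatrix p)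
      = (LocalElem.truncate n (fun _ => okMatrix p false) * b *
        LocalElem.truncate n fun _ => (okMatrix p false)⁻¹).toFun i * refMatrix p := by
  have htranspose (x : M2) : xᵀᴴᵀ = xᴴ := rfl
  rw [side_true, LocalElem.star_toFun, LocalElem.rightStar_toFun, htranspose]
  simp only [LocalElem.mul_toFun, LocalElem.truncate_toFun]
  split_ifs with hi
  · exact refMatrix_mul_conjTranspose_conj hm _
  · rw [hb i (not_lt.1 hi), Matrix.conjTranspose_one, Matrix.mul_one,
      Matrix.nonsing_inv_mul _ ((Matrix.isUnit_iff_isUnit_det _).1 hm), Matrix.conjTranspose_one,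
      Matrix.mul_one, Matrix.mul_one, Matrix.mul_one, Matrix.one_mul]

lemma star_rightStar_apply_refVector (hm : IsUnit (refMatrix p))
    (hb : ∀ i, n ≤ i → b.toFun i = 1) (hA : IsSideMul false b A)
    (hB : IsSideMul true (b.rightStar hm) B)
    (hP : IsSideMul false (LocalElem.truncate n fun _ => okMatrix p false) P) :
    (star B) (refVector p) = (P * A * Ring.inverse P) (refVector p) := by
  have hPAP := (hP.mul hA).mul (hP.ringInverse (isUnit_okMatrix hm))
  exact (hB.star.apply_refVector (side_star_rightStar_refMatrix hm hb)).trans (hPAP _).symm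

lemma conj_mem_graph_modularOp (hm : IsUnit (refMatrix p)) (hb : ∀ i, n ≤ i → b.toFun i = 1)
    (hA : IsSideMul false b A)
    (hP : IsSideMul false (LocalElem.truncate n fun _ => okMatrix p false) P) :
    (A (refVector p), (P * A * Ring.inverse P) (refVector p))
      ∈ (tomitaPair hm).modularOp.graph := by
  obtain ⟨B, hB⟩ := exists_isSideMul (p := p) true (b.rightStar hm)
  have hleft : A ∈ leftAlg p := leftAlg_eq p ▸ mem_sideStarAlg.1 hA.mem_sideStarAlg
  have hright : B ∈ rightAlg p := rightAlg_eq p ▸ mem_sideStarAlg.1 hB.mem_sideStarAlg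
  rw [TomitaPair.graph_modularOp]
  exact ⟨(star A) (refVector p), subset_closure ⟨A, hleft, rfl⟩, subset_closure ⟨B, hright,
    Prod.ext (star_apply_refVector hm hA hB) (star_rightStar_apply_refVector hm hb hA hB hP).symm⟩⟩

end Conjugation

section Okounkov

variable {J : L2X p ≃ₗᵢ[ℂ] TensorH p}

lemma isSideMul_okounkovProd {O : ℕ → (L2X p →L[ℂ] L2X p)} {e : M2}
    (hO : ∀ k, pushOp J (O k) = siteOp k (side false e)) (n : ℕ) :
    IsSideMul false (LocalElem.truncate n fun _ => e) (okounkovProd J O n) := by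
  simp only [okounkovProd, hO]
  exact isSideMul_prod_siteOp false (fun _ => e) n

lemma isOkounkov (hp : ∀ z, p z ≠ 0) {π : Wreath × Wreath →* unitary (L2X p →L[ℂ] L2X p)}
    (hπ : IsRepMu p π) (hJ : IsTensorId p J) (k : ℕ) :
    IsOkounkov π k (J.conjStarAlgEquiv.symm (siteOp k (side false (okMatrix p false)))) := by
  intro ζ
  have hlim := (J.symm.continuous.tendsto _).comp
    (tendsto_average_transp hp hπ hJ false k (J ζ))
  refine hlim.congr fun n => ?_
  simp only [Function.comp_apply, map_smul, map_sum,
    LinearIsometryEquiv.conjStarAlgEquiv_apply_apply, LinearIsometryEquiv.symm_apply_apply]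
  rfl

end Okounkov

end

theorem proposition4 (p : PMF Site) (hp : ∀ z, p z ≠ 0) :
    -- the objects exist
    (∃ π : Wreath × Wreath →* unitary (L2X p →L[ℂ] L2X p), IsRepMu p π) ∧
    (∃ J : L2X p ≃ₗᵢ[ℂ] TensorH p, IsTensorId p J) ∧
    (∀ b : LocalElem, (∃ T : TensorH p →L[ℂ] TensorH p, IsLeftMul b T) ∧
      ∃ T : TensorH p →L[ℂ] TensorH p, IsRightMul b T) ∧
    ∀ (π : Wreath × Wreath →* unitary (L2X p →L[ℂ] L2X p)) (J : L2X p ≃ₗᵢ[ℂ] TensorH p),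
      IsRepMu p π → IsTensorId p J →
      -- the generated algebras
      doubleCommutant (rep0 π) = pullOp J '' leftAlg p ∧
      doubleCommutant (rep1 π) = pullOp J '' rightAlg p ∧
      -- the modular operator
      ((Matrix.of fun k l : Fin 2 => (p (k, l)).toReal).det ≠ 0 →
        ∃ (O : ℕ → (L2X p →L[ℂ] L2X p)) (Δ : TensorH p →ₗ.[ℂ] TensorH p),
          (∀ k, IsOkounkov π k (O k) ∧ IsUnit (O k)) ∧
          IsModularOperator (leftAlg p) (rightAlg p) (refVector p) Δ ∧
          (∀ (n : ℕ) (a : LocalElem) (A : TensorH p →L[ℂ] TensorH p),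
            (∀ i, n ≤ i → a.toFun i = 1) → IsLeftMul a A →
            (A (refVector p),
              (okounkovProd J O n * A * Ring.inverse (okounkovProd J O n)) (refVector p))
                ∈ Δ.graph) ∧
          Δ.HasCore (localVectors p)) := by
  refine ⟨exists_isRepMu hp, exists_isTensorId hp, fun b => ⟨exists_isSideMul false b,
    (exists_isSideMul true _).imp fun T => (isRightMul_iff b T).2⟩, fun π J hπ hJ =>
    ⟨doubleCommutant_rep hp hπ hJ false, ?_, fun hdet => ?_⟩⟩
  · rw [rightAlg_eq]
    exact doubleCommutant_rep hp hπ hJ true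
  have hm := isUnit_refMatrix hdet
  refine ⟨fun k => J.conjStarAlgEquiv.symm (siteOp k (side false (okMatrix p false))),
    (tomitaPair hm).modularOp, fun k => ⟨isOkounkov hp hπ hJ k, ?_⟩,
    (tomitaPair hm).isModularOperator, fun n a A ha hA => ?_, ?_⟩
  · exact (((isUnit_okMatrix hm).map (side false)).map (siteOp (p := p) k)).map
      J.conjStarAlgEquiv.symm
  · exact conj_mem_graph_modularOp hm ha hA
      (isSideMul_okounkovProd (fun k => J.conjStarAlgEquiv.apply_symm_apply _) n)
  · rw [localVectors_eq hm]
    exact (tomitaPair hm).hasCore
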